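/- For $t\ge 0$ let $\gamma_t=\{z\in\mathbb C: |z e^{1-z}|=e^{-t},\ |z|\le 1\}$, and let $D_t^+$ and $D_t^-$ be the interior and the exterior of this closed curve. Let $\mathrm W_0$ be the principal branch of the Lambert function ($\mathrm W_0(u)e^{\mathrm W_0(u)}=u$), and let $$S(z,t)=-\mathrm W_0\!\left(-e^{-2(t+1)}z^{-1}e^{z}\right).$$ Let $x_1\le x_2$ be the smallest and the largest real solution of $e^x/x=e^{2t+1}$. The harmonic moments of $\gamma_t$ are $$C_k(t)=-\frac1\pi\iint_{D_t^-}z^{-k}\,dx\,dy\quad(k\ge 1),\qquad C_{-k}(t)=\frac1\pi\iint_{D_t^+}z^{k}\,dx\,dy\quad(k\ge 0),$$ where the integral over the exterior is understood as $\lim_{R\to\infty}\iint_{D_t^-\cap\{|z|<R\}}$. For every $t\ge 0$: 1. All these moments exist: the integrals over $D_t^+$ and over $D_t^-\cap\{|z|<R\}$ converge absolutely, the limits $R\to\infty$ exist, and for $k\ge 3$ the integral over $D_t^-$ converges absolutely and gives the same value. 2. If $t>0$, then $0<x_1<1<x_2$; the function $S(\cdot,t)$ is analytic at every point of $\gamma_t$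 and of the annulus $x_1<|z|<x_2$; for $z$ in the union of these two sets, $\bar z=S(z,t)$ if and only if $z\in\gamma_t$ (so $S(\cdot,t)$ is the Schwarz function of $\gamma_t$); and the moments are its Laurent coefficients on the annulus: $$S(z,t)=\sum_{k=-\infty}^{\infty}C_k(t)\,z^{k-1},\qquad x_1<|z|<x_2 ,$$ with absolute convergence. 3. For every $k\in\mathbb Z$, $$C_k(t)=\sum_{n=\max(1,1-k)}^{\infty}\frac{n^{k+2n-2}}{(n+k-1)!\,n!}\,e^{-2(t+1)n}.$$ -/

import Mathlib

open scoped Nat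

noncomputable section

/-- The curve `γ_t = {z : |z e^{1-z}| = e^{-t}, |z| ≤ 1}`. -/
def szegoCurve (t : ℝ) : Set ℂ :=
  {z | ‖z * Complex.exp (1 - z)‖ = Real.exp (-t) ∧ ‖z‖ ≤ 1}

/-- The interior of a closed curve `Γ`: the points off `Γ` whose connected component in the
complement of `Γ` is bounded. -/
def curveInterior (Γ : Set ℂ) : Set ℂ :=
  {z | z ∉ Γ ∧ Bornology.IsBounded (connectedComponentIn Γᶜ z)}

/-- The exterior of a closed curve `Γ`: the points off `Γ` whose connected component in the
complement of `Γ` is unbounded. -/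
def curveExterior (Γ : Set ℂ) : Set ℂ :=
  {z | z ∉ Γ ∧ ¬ Bornology.IsBounded (connectedComponentIn Γᶜ z)}

/-- The range of the principal branch of the Lambert function: the part of the strip `|Im w| < π`
to the right of the curve `{-y cot y + i y : -π < y < π}` (which passes through `-1` at `y = 0`),
with the half `y ≥ 0` of that curve included. -/
def lambertPrincipalRange : Set ℂ :=
  {w | |w.im| < Real.pi ∧ (w.im = 0 → -1 ≤ w.re) ∧
    (0 < w.im → -(w.im * Real.cot w.im) ≤ w.re) ∧
    (w.im < 0 → -(w.im * Real.cot w.im) < w.re)}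

/-- The principal branch `W₀` of the Lambert function: the solution of `w e^w = z` in the principal
range. On the branch cut `(-∞, -1/e)` the value is the limit from above; `W₀(-1/e) = -1`. -/
def lambertW0 (z : ℂ) : ℂ :=
  Classical.epsilon fun w : ℂ => w ∈ lambertPrincipalRange ∧ w * Complex.exp w = z

/-- `S(z,t) = -W₀(-e^{-2(t+1)} z⁻¹ e^z)`. -/
def schwarzS (t : ℝ) (z : ℂ) : ℂ :=
  -lambertW0 (-(Complex.exp (-2 * ((t : ℂ) + 1)) * z⁻¹ * Complex.exp z))

/-- The smallest solution `x₁` of `e^x / x = e^{2t+1}`. -/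
def innerRadius (t : ℝ) : ℝ := sInf {x : ℝ | Real.exp x / x = Real.exp (2 * t + 1)}

/-- The largest solution `x₂` of `e^x / x = e^{2t+1}`. -/
def outerRadius (t : ℝ) : ℝ := sSup {x : ℝ | Real.exp x / x = Real.exp (2 * t + 1)}

/-- The annulus `x₁ < |z| < x₂`. -/
def laurentAnnulus (t : ℝ) : Set ℂ := {z | innerRadius t < ‖z‖ ∧ ‖z‖ < outerRadius t}

/-- `-(1/π) ∬ z^{-k} dx dy` over the part of the exterior of `γ_t` in the disk `|z| < R`. -/
def truncatedExteriorMoment (t : ℝ) (k : ℤ) (R : ℝ) : ℂ :=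
  -(1 / (Real.pi : ℂ)) * ∫ z in curveExterior (szegoCurve t) ∩ Metric.ball 0 R, z ^ (-k)

/-- The harmonic moments `C_k(t)`, `k ∈ ℤ`, of `γ_t`. For `k ≥ 1` the integral over the exterior
is the limit of the integrals over its intersections with the disks `|z| < R` as `R → ∞`
(`z^{-1}` and `z^{-2}` are not absolutely integrable at infinity). -/
def harmonicMoment (t : ℝ) (k : ℤ) : ℂ :=
  if 1 ≤ k then Filter.limUnder Filter.atTop (truncatedExteriorMoment t k)
  else (1 / (Real.pi : ℂ)) * ∫ z in curveInterior (szegoCurve t), z ^ (-k)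

end

/-! The engine is the generalized Abel identity ∑ (m+j)^{j-1}/j! u^j = e^{mT(u)}/m for m ≠ 0, where
T inverts w ↦ w e^{-w}; for m = 0 the series is T(u) itself (`abelSeries_eq_exp`,
`abelSeries_zero`). It holds on the closed disk |u| ≤ 1/e because the coefficients times e^{-j} are
O(j^{-3/2}), and this is what admits t = 0.

In polar coordinates γ_t reads r e^{-r cos θ} = e^{-(1+t)}, so r cos θ = T(cos θ e^{-(1+t)}) and log
r = T(cos θ e^{-(1+t)}) - (1+t). Integrating z^{-k} radially leaves r^{2-k}/(2-k), or log r when k =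
2. Up to constants both are the Abel series with m = 2-k at u = cos θ e^{-(1+t)}
(`powPrimitive_szegoRadius`). Hence interior and exterior moments are the same Fourier integral
(`harmonicMoment_eq`); the circle |z| = R contributes a constant in θ, which e^{-ikθ} with k ≥ 1
integrates to 0. The Fourier coefficients of cos^j θ then give the explicit series
(`hasSum_momentTerm`).

For t > 0, the curve equation is equivalent to z̄ e^{-z̄} = e^{-2(t+1)} e^z/z, and applying T turns
this into z̄ = S(z,t) (`conj_eq_schwarzS_iff`). On the annulus, expanding T in powers of its
argument and then each e^{nz} gives an absolutely convergent double series. Grouped by powers of z,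
its terms are those of the explicit formula, so moments and Laurent coefficients agree term by term,
without contour integration (`hasSum_harmonicMoment_mul_zpow`). -/

noncomputable section

/-! ### The generalized Abel series and its exponential form -/

/-- The coefficients `(m + j)^{j-1} / j!` of the generalized Abel series. -/
def abelCoeff (m : ℤ) (j : ℕ) : ℂ := ((m + j : ℤ) : ℂ) ^ ((j : ℤ) - 1) / (j ! : ℂ)

/-- The series `∑ (m + j)^{j-1} / j! u^j`. -/
def abelSeries (m : ℤ) (u : ℂ) : ℂ := ∑' j : ℕ, abelCoeff m j * u ^ j

/-- The tree function `T(u) = -W₀(-u)`. -/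
def treeFun (u : ℂ) : ℂ := u * abelSeries 1 u

/-- Stirling's lower bound for j! against |m+j|^{j-1} ≤ j^{j-1} e^{|m|}. The exponent 3/2 gives
absolute convergence up to the boundary |u| = 1/e, which is reached when t = 0. -/
theorem norm_abelCoeff_mul_exp_le (m : ℤ) (j : ℕ) (hj : 1 ≤ j) :
    ‖abelCoeff m j‖ * Real.exp (-1) ^ j ≤ Real.exp |(m : ℝ)| * (1 / (j : ℝ) ^ (3 / 2 : ℝ)) := by
  obtain ⟨i, rfl⟩ : ∃ i, j = i + 1 := ⟨j - 1, by omega⟩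
  have hj0 : (0 : ℝ) < ((i + 1 : ℕ) : ℝ) := by positivity
  set J : ℝ := ((i + 1 : ℕ) : ℝ) with hJ
  have h1 : ‖abelCoeff m (i + 1)‖ = |(m : ℝ) + J| ^ i / ((i + 1)! : ℝ) := by
    have e : (((i + 1 : ℕ) : ℤ) - 1) = (i : ℕ) := by push_cast; ring
    rw [abelCoeff, e, zpow_natCast, norm_div, norm_pow, Complex.norm_intCast, Complex.norm_natCast]
    push_cast [hJ]; rfl
  have h2 : |(m : ℝ) + J| ^ i ≤ J ^ i * Real.exp |(m : ℝ)| := by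
    calc |(m : ℝ) + J| ^ i ≤ (J * Real.exp (|(m : ℝ)| / J)) ^ i := by
          gcongr
          calc |(m : ℝ) + J| ≤ |(m : ℝ)| + J := by
                simpa [abs_of_pos hj0] using abs_add_le (m : ℝ) J
            _ = J * (|(m : ℝ)| / J + 1) := by field_simp
            _ ≤ _ := by gcongr; exact Real.add_one_le_exp _
      _ = J ^ i * Real.exp (i * (|(m : ℝ)| / J)) := by rw [mul_pow, ← Real.exp_nat_mul]
      _ ≤ _ := by
          gcongr
          rw [← mul_div_assoc, div_le_iff₀ hj0, mul_comm]
          gcongr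
          simp [hJ]
  have h3 := Stirling.le_factorial_stirling (i + 1)
  rw [← hJ] at h3
  have h4 : √J ≤ √(2 * Real.pi * J) := by
    apply Real.sqrt_le_sqrt
    nlinarith [Real.pi_gt_three]
  have h5 : √J * J ^ (i + 1) * Real.exp (-1) ^ (i + 1) ≤ ((i + 1)! : ℝ) := by
    refine le_trans ?_ h3
    rw [mul_assoc, ← mul_pow, Real.exp_neg, ← div_eq_mul_inv]
    gcongr
  have h6 : J ^ (3 / 2 : ℝ) = √J * J := by
    rw [Real.sqrt_eq_rpow, ← Real.rpow_add_one hj0.ne']; norm_num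
  have hs : 0 < √J := Real.sqrt_pos.2 hj0
  rw [h1, h6, mul_one_div, div_mul_eq_mul_div, div_le_div_iff₀ (by positivity) (by positivity)]
  calc |(m : ℝ) + J| ^ i * Real.exp (-1) ^ (i + 1) * (√J * J)
      ≤ J ^ i * Real.exp |(m : ℝ)| * Real.exp (-1) ^ (i + 1) * (√J * J) := by gcongr
    _ = Real.exp |(m : ℝ)| * (√J * J ^ (i + 1) * Real.exp (-1) ^ (i + 1)) := by ring
    _ ≤ _ := by gcongr

theorem summable_norm_abelCoeff (m : ℤ) :
    Summable fun j : ℕ => ‖abelCoeff m j‖ * Real.exp (-1) ^ j := by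
  rw [← summable_nat_add_iff 1]
  have := ((Real.summable_one_div_nat_rpow (p := 3 / 2)).2 (by norm_num)).mul_left
    (Real.exp |(m : ℝ)|)
  exact ((summable_nat_add_iff 1).2 this).of_nonneg_of_le (fun _ => by positivity)
    fun j => norm_abelCoeff_mul_exp_le m (j + 1) (by omega)

theorem norm_abelCoeff_mul_pow_le (m : ℤ) (j : ℕ) {u : ℂ} (hu : ‖u‖ ≤ Real.exp (-1)) :
    ‖abelCoeff m j * u ^ j‖ ≤ ‖abelCoeff m j‖ * Real.exp (-1) ^ j := by
  rw [norm_mul, norm_pow]; gcongr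

theorem hasSum_abelSeries (m : ℤ) {u : ℂ} (hu : ‖u‖ ≤ Real.exp (-1)) :
    HasSum (fun j : ℕ => abelCoeff m j * u ^ j) (abelSeries m u) :=
  (Summable.of_norm_bounded (summable_norm_abelCoeff m)
    fun j => norm_abelCoeff_mul_pow_le m j hu).hasSum

theorem continuousOn_abelSeries (m : ℤ) :
    ContinuousOn (abelSeries m) (Metric.closedBall 0 (Real.exp (-1))) := by
  refine continuousOn_tsum (fun j => by fun_prop) (summable_norm_abelCoeff m) ?_
  intro j u hu
  exact norm_abelCoeff_mul_pow_le m j (by simpa using hu)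

theorem analyticOnNhd_abelSeries (m : ℤ) :
    AnalyticOnNhd ℂ (abelSeries m) (Metric.ball 0 (Real.exp (-1))) := by
  refine DifferentiableOn.analyticOnNhd ?_ Metric.isOpen_ball
  refine Complex.differentiableOn_tsum_of_summable_norm (summable_norm_abelCoeff m)
    (fun j => by fun_prop) Metric.isOpen_ball ?_
  intro j u hu
  exact norm_abelCoeff_mul_pow_le m j (by simpa using (Metric.ball_subset_closedBall hu))

theorem abelCoeff_zero_succ (j : ℕ) : abelCoeff 0 (j + 1) = abelCoeff 1 j := by
  have h : ((j : ℂ) + 1) ≠ 0 := Nat.cast_add_one_ne_zero j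
  have h2 : (j ! : ℂ) ≠ 0 := by exact_mod_cast j.factorial_ne_zero
  simp only [abelCoeff, Nat.factorial_succ]
  push_cast
  rw [show ((j : ℤ) + 1 - 1) = j - 1 + 1 by ring, zero_add, zpow_add_one₀ h, add_comm (1 : ℂ)]
  field_simp

theorem abelSeries_zero {u : ℂ} (hu : ‖u‖ ≤ Real.exp (-1)) : abelSeries 0 u = treeFun u := by
  have h := hasSum_abelSeries 0 hu
  rw [abelSeries, h.summable.tsum_eq_zero_add, treeFun, abelSeries, ← tsum_mul_left]
  simp only [abelCoeff_zero_succ]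
  -- The constant term vanishes because 0^{-1} = 0.
  simp [abelCoeff, pow_succ]
  congr 1; ext j; ring

/-- Vanishing of high finite differences of a power. -/
theorem sum_abel_finite_difference (m : ℂ) (N : ℕ) :
    ∑ j ∈ Finset.range (N + 2),
      (m + j) ^ N * (-1 : ℂ) ^ (N + 1 - j) * ((N + 1).choose j : ℂ) = 0 := by
  have h := fwdDiff_iter_eq_sum_shift (1 : ℂ) (fun x : ℂ => x ^ N) (N + 1) m
  rw [fwdDiff_iter_pow_eq_zero_of_lt (by omega)] at h
  rw [Pi.zero_apply] at h
  rw [h]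
  refine Finset.sum_congr rfl fun j _ => ?_
  simp; ring

/-- These are the terms of total degree N in w after expanding e^{-(m+j)w}. For N + 1 in place of N
the powers of m+j combine to (m+j)^N, and the alternating binomial sum is an (N+1)-st difference of
a polynomial of degree N. -/
theorem abelSeries_double_term (m : ℤ) (hm : m ≠ 0) (w : ℂ) (N : ℕ) :
    ∑ p ∈ Finset.HasAntidiagonal.antidiagonal N, abelCoeff m p.1 * w ^ p.1 *
      ((-((m + p.1 : ℤ) * w)) ^ p.2 / (p.2 ! : ℂ)) = if N = 0 then (m : ℂ)⁻¹ else 0 := by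
  have hm' : (m : ℂ) ≠ 0 := by exact_mod_cast hm
  rcases N with _ | N
  · simp [abelCoeff]
  simp only [Nat.add_eq_zero_iff, one_ne_zero, and_false, if_false]
  rw [Finset.Nat.sum_antidiagonal_eq_sum_range_succ
    (fun a b => abelCoeff m a * w ^ a * ((-((m + a : ℤ) * w)) ^ b / (b ! : ℂ)))]
  have := congrArg (fun x => x * (w ^ (N + 1) / ((N + 1)! : ℂ))) (sum_abel_finite_difference m N)
  simp only [zero_mul, Finset.sum_mul] at this
  rw [← this]
  refine Finset.sum_congr rfl fun j hj => ?_
  have hj' : j ≤ N + 1 := by simp at hj; omega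
  obtain ⟨i, hi⟩ : ∃ i, N + 1 = j + i := ⟨N + 1 - j, by omega⟩
  have hi' : N + 1 - j = i := by omega
  have key : ((m + j : ℤ) : ℂ) ^ ((j : ℤ) - 1) * ((m + j : ℤ) : ℂ) ^ i = ((m : ℂ) + j) ^ N := by
    rcases j with _ | j
    · simp only [Nat.cast_zero, add_zero]
      obtain rfl : i = N + 1 := by omega
      rw [pow_succ']
      simp [hm']
    · rw [show (((j + 1 : ℕ) : ℤ) - 1) = (j : ℕ) by push_cast; ring, zpow_natCast, ← pow_add,
        show j + i = N by omega]
      push_cast; rfl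
  rw [hi', abelCoeff, ← key, Nat.choose_eq_factorial_div_factorial hj', hi',
    Nat.cast_div (hi' ▸ Nat.factorial_mul_factorial_dvd_factorial hj') (by
      exact_mod_cast (Nat.mul_pos j.factorial_pos i.factorial_pos).ne'), hi]
  have h1 : (j ! : ℂ) ≠ 0 := by exact_mod_cast j.factorial_ne_zero
  have h2 : (i ! : ℂ) ≠ 0 := by exact_mod_cast i.factorial_ne_zero
  have h3 : ((j + i) ! : ℂ) ≠ 0 := by exact_mod_cast (j + i).factorial_ne_zero
  rw [neg_pow, mul_pow, pow_add]
  push_cast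
  field_simp

/-- The radius 1/4 is a convenient choice: |w|e^{|w|} ≤ 1/e lets ∑ |a_j| e^{-j} dominate the double
series. -/
theorem mul_exp_le_exp_neg_one {w : ℂ} (hw : ‖w‖ ≤ 1 / 4) :
    ‖w‖ * Real.exp ‖w‖ ≤ Real.exp (-1) := by
  have h1 : Real.exp ‖w‖ ≤ Real.exp (1 / 4) := Real.exp_le_exp.2 hw
  have h2 : Real.exp (1 / 4) * (1 / 4) ≤ Real.exp (-1) := by
    have h3 : Real.exp (1 / 4) = Real.exp (5 / 4) * Real.exp (-1) := by
      rw [← Real.exp_add]; norm_num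
    have h4 : Real.exp (5 / 4) ≤ 4 := by
      -- Raised to the fourth power, the claim is e^5 ≤ 256.
      have : Real.exp (5 / 4) ^ 4 ≤ 4 ^ 4 := by
        rw [← Real.exp_nat_mul]
        have : Real.exp ((4 : ℕ) * (5 / 4)) = Real.exp 1 ^ 5 := by
          rw [← Real.exp_nat_mul]; norm_num
        rw [this]
        calc Real.exp 1 ^ 5 ≤ 2.7182818286 ^ 5 := by
              gcongr; exact Real.exp_one_lt_d9.le
          _ ≤ _ := by norm_num
      exact le_of_pow_le_pow_left₀ (by norm_num) (by norm_num) this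
    rw [h3]
    nlinarith [Real.exp_pos (-1)]
  calc ‖w‖ * Real.exp ‖w‖ ≤ 1 / 4 * Real.exp (1 / 4) := by gcongr
    _ ≤ _ := by linarith

theorem hasSum_complex_exp (z : ℂ) : HasSum (fun i : ℕ => z ^ i / (i ! : ℂ)) (Complex.exp z) := by
  rw [Complex.exp_eq_exp_ℂ]
  exact NormedSpace.expSeries_div_hasSum_exp z

theorem hasSum_real_exp (x : ℝ) : HasSum (fun i : ℕ => x ^ i / (i ! : ℝ)) (Real.exp x) := by
  rw [Real.exp_eq_exp_ℝ]
  exact NormedSpace.expSeries_div_hasSum_exp x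

/-- The double series is summed in two ways: by rows it gives the exponentials, by antidiagonals
only the term of degree 0 survives. -/
theorem hasSum_abelSeries_mul_exp_neg {m : ℤ} (hm : m ≠ 0) {w : ℂ} (hw : ‖w‖ ≤ 1 / 4) :
    HasSum (fun j : ℕ => abelCoeff m j * w ^ j * Complex.exp (-((m + j : ℤ) * w)))
      (m : ℂ)⁻¹ := by
  set f : ℕ × ℕ → ℂ := fun p => abelCoeff m p.1 * w ^ p.1 *
      ((-((m + p.1 : ℤ) * w)) ^ p.2 / (p.2 ! : ℂ)) with hf
  have hrow : ∀ j : ℕ, HasSum (fun i => f (j, i))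
      (abelCoeff m j * w ^ j * Complex.exp (-((m + j : ℤ) * w))) := by
    intro j
    exact (hasSum_complex_exp (-((m + j : ℤ) * w))).mul_left (abelCoeff m j * w ^ j)
  have hnrow : ∀ j : ℕ, HasSum (fun i => ‖f (j, i)‖)
      (‖abelCoeff m j * w ^ j‖ * Real.exp ‖((m + j : ℤ) * w)‖) := by
    intro j
    have h := (hasSum_real_exp ‖((m + j : ℤ) * w)‖).mul_left ‖abelCoeff m j * w ^ j‖
    refine h.congr_fun fun i => ?_
    rw [hf, norm_mul, norm_div, norm_pow, norm_neg, Complex.norm_natCast]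
  have hsum : Summable f := by
    apply Summable.of_norm
    rw [summable_prod_of_nonneg (fun _ => norm_nonneg _)]
    refine ⟨fun j => (hnrow j).summable, ?_⟩
    simp only [(hnrow _).tsum_eq]
    refine ((summable_norm_abelCoeff m).mul_left (Real.exp (|(m : ℝ)| * ‖w‖))).of_nonneg_of_le
      (fun _ => by positivity) fun j => ?_
    have h1 : ‖((m + j : ℤ) * w)‖ ≤ |(m : ℝ)| * ‖w‖ + j * ‖w‖ := by
      rw [norm_mul, ← add_mul]
      gcongr
      push_cast
      refine (norm_add_le _ _).trans ?_
      simp [Complex.norm_intCast]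
    calc ‖abelCoeff m j * w ^ j‖ * Real.exp ‖((m + j : ℤ) * w)‖
        ≤ ‖abelCoeff m j * w ^ j‖ * Real.exp (|(m : ℝ)| * ‖w‖ + j * ‖w‖) := by gcongr
      _ = Real.exp (|(m : ℝ)| * ‖w‖) * (‖abelCoeff m j‖ * (‖w‖ * Real.exp ‖w‖) ^ j) := by
          rw [Real.exp_add, Real.exp_nat_mul, norm_mul, norm_pow, mul_pow]; ring
      _ ≤ _ := by
          gcongr
          exact mul_exp_le_exp_neg_one hw
  have h1 : HasSum (fun j : ℕ => abelCoeff m j * w ^ j * Complex.exp (-((m + j : ℤ) * w)))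
      (∑' p, f p) := hsum.hasSum.prod_fiberwise hrow
  have h2 : HasSum (fun N : ℕ => if N = 0 then (m : ℂ)⁻¹ else 0) (∑' p, f p) := by
    have := (Finset.HasAntidiagonal.sigmaAntidiagonalEquivProd (A := ℕ)).hasSum_iff.2 hsum.hasSum
    refine this.sigma fun N => ?_
    rw [← abelSeries_double_term m hm w N]
    exact Finset.hasSum (Finset.HasAntidiagonal.antidiagonal N) f
  rwa [h2.unique (hasSum_ite_eq 0 _)] at h1

theorem abelSeries_mul_exp_neg {m : ℤ} (hm : m ≠ 0) {w : ℂ} (hw : ‖w‖ ≤ 1 / 4) :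
    m * abelSeries m (w * Complex.exp (-w)) = Complex.exp (m * w) := by
  have hm' : (m : ℂ) ≠ 0 := by exact_mod_cast hm
  have h := ((hasSum_abelSeries_mul_exp_neg hm hw).mul_left (m * Complex.exp (m * w))).tsum_eq
  rw [abelSeries, ← tsum_mul_left]
  convert! h using 1
  · congr 1; ext j
    rw [mul_pow, ← Complex.exp_nat_mul]
    have : Complex.exp (j * -w) = Complex.exp (m * w) * Complex.exp (-((m + j : ℤ) * w)) := by
      rw [← Complex.exp_add]; push_cast; ring_nf
    rw [this]; ring
  · field_simp

/-! ### Radial monotonicity of |z e^{1-z}| and the star-shaped domain -/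

/-- The part of the open unit disk where `|z e^{1-z}| < e^{-t}`. -/
def szegoDomain (t : ℝ) : Set ℂ :=
  {z | ‖z‖ < 1 ∧ ‖z * Complex.exp (1 - z)‖ < Real.exp (-t)}

theorem norm_mul_exp_one_sub (z : ℂ) :
    ‖z * Complex.exp (1 - z)‖ = ‖z‖ * Real.exp (1 - z.re) := by
  simp [Complex.norm_exp]

/-- From s ≤ e^{s-1} and Re z ≤ 1: inside the unit disk |z e^{1-z}| does not decrease along rays
from 0. -/
theorem norm_smul_mul_exp_le {z : ℂ} (hz : ‖z‖ ≤ 1) {s : ℝ} (hs0 : 0 ≤ s) (hs1 : s ≤ 1) :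
    ‖(s • z) * Complex.exp (1 - s • z)‖ ≤ ‖z * Complex.exp (1 - z)‖ := by
  rw [norm_mul_exp_one_sub, norm_mul_exp_one_sub, norm_smul, Real.norm_of_nonneg hs0,
    Complex.real_smul, Complex.re_ofReal_mul]
  have hx : z.re ≤ 1 := (Complex.re_le_norm z).trans hz
  have h1 : s * Real.exp (1 - s * z.re) ≤ Real.exp (1 - z.re) := by
    calc s * Real.exp (1 - s * z.re) ≤ Real.exp (s - 1) * Real.exp (1 - s * z.re) := by
          gcongr
          linarith [Real.add_one_le_exp (s - 1)]
      _ = Real.exp (s - s * z.re) := by rw [← Real.exp_add]; ring_nf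
      _ ≤ _ := by
          apply Real.exp_le_exp.2
          nlinarith
  calc s * ‖z‖ * Real.exp (1 - s * z.re) = ‖z‖ * (s * Real.exp (1 - s * z.re)) := by ring
    _ ≤ _ := by gcongr

theorem isOpen_szegoDomain (t : ℝ) : IsOpen (szegoDomain t) := by
  refine IsOpen.and ?_ ?_ <;> exact isOpen_lt (by fun_prop) (by fun_prop)

theorem zero_mem_szegoDomain (t : ℝ) : (0 : ℂ) ∈ szegoDomain t := by
  simp [szegoDomain, Real.exp_pos]

theorem starConvex_szegoDomain (t : ℝ) : StarConvex ℝ 0 (szegoDomain t) := by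
  rw [starConvex_zero_iff]
  intro z hz s hs0 hs1
  refine ⟨?_, (norm_smul_mul_exp_le hz.1.le hs0 hs1).trans_lt hz.2⟩
  rw [norm_smul, Real.norm_of_nonneg hs0]
  exact (mul_le_of_le_one_left (norm_nonneg z) hs1).trans_lt hz.1

theorem isPreconnected_szegoDomain (t : ℝ) : IsPreconnected (szegoDomain t) :=
  ((starConvex_szegoDomain t).isPathConnected (zero_mem_szegoDomain t)).isConnected.isPreconnected

theorem norm_mul_exp_neg_lt_of_mem_szegoDomain {w : ℂ} (hw : w ∈ szegoDomain 0) :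
    ‖w * Complex.exp (-w)‖ < Real.exp (-1) := by
  have h := hw.2
  rw [norm_mul_exp_one_sub, sub_eq_add_neg, Real.exp_add] at h
  rw [norm_mul, Complex.norm_exp, Complex.neg_re]
  have h1 : Real.exp (-1) * Real.exp 1 = 1 := by rw [← Real.exp_add]; simp
  have := mul_lt_mul_of_pos_left h (Real.exp_pos (-1))
  simp only [neg_zero, Real.exp_zero, mul_one] at this
  calc _ = Real.exp (-1) * (‖w‖ * (Real.exp 1 * Real.exp (-w.re))) := by
        linear_combination (-(‖w‖ * Real.exp (-w.re))) * h1
    _ < _ := this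

theorem mem_szegoDomain_zero_of_norm_lt {w : ℂ} (hw : ‖w‖ < 1)
    (h : ‖w * Complex.exp (-w)‖ < Real.exp (-1)) : w ∈ szegoDomain 0 := by
  refine ⟨hw, ?_⟩
  rw [sub_eq_add_neg, Complex.exp_add, mul_left_comm, norm_mul, Complex.norm_exp]
  have := mul_lt_mul_of_pos_left h (Real.exp_pos 1)
  simpa [← Real.exp_add] using this

/-! ### The tree function as the inverse of w e^{-w} -/

theorem analyticOnNhd_treeFun : AnalyticOnNhd ℂ treeFun (Metric.ball 0 (Real.exp (-1))) :=
  analyticOnNhd_id.mul (analyticOnNhd_abelSeries 1)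

theorem continuousOn_treeFun :
    ContinuousOn treeFun (Metric.closedBall 0 (Real.exp (-1))) :=
  continuousOn_id.mul (continuousOn_abelSeries 1)

theorem treeFun_mul_exp_neg_of_small {w : ℂ} (hw : ‖w‖ ≤ 1 / 4) :
    treeFun (w * Complex.exp (-w)) = w := by
  have h := abelSeries_mul_exp_neg one_ne_zero hw
  simp only [Int.cast_one, one_mul] at h
  rw [treeFun, h, mul_assoc, ← Complex.exp_add]
  simp

/-- Two analytic functions on the disk `|u| < 1/e` that agree at `w e^{-w}` for small `w` agree on
the disk. -/
theorem eqOn_ball_of_eq_mul_exp_neg {f g : ℂ → ℂ}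
    (hf : AnalyticOnNhd ℂ f (Metric.ball 0 (Real.exp (-1))))
    (hg : AnalyticOnNhd ℂ g (Metric.ball 0 (Real.exp (-1))))
    (h : ∀ w : ℂ, ‖w‖ ≤ 1 / 4 → f (w * Complex.exp (-w)) = g (w * Complex.exp (-w))) :
    Set.EqOn f g (Metric.ball 0 (Real.exp (-1))) := by
  refine hf.eqOn_of_preconnected_of_frequently_eq hg (convex_ball _ _).isPreconnected
    (z₀ := 0) (by simp [Real.exp_pos]) ?_
  have ht : Filter.Tendsto (fun w : ℂ => w * Complex.exp (-w)) (nhdsWithin 0 {0}ᶜ)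
      (nhdsWithin 0 {0}ᶜ) := by
    refine tendsto_nhdsWithin_iff.2 ⟨?_, ?_⟩
    · have : Continuous fun w : ℂ => w * Complex.exp (-w) := by fun_prop
      have h0 := this.tendsto 0
      simp only [zero_mul] at h0
      exact h0.mono_left nhdsWithin_le_nhds
    · filter_upwards [self_mem_nhdsWithin] with w hw
      simpa using hw
  refine ht.frequently (Filter.Eventually.frequently ?_)
  have : ∀ᶠ w : ℂ in nhds 0, ‖w‖ ≤ 1 / 4 := by
    filter_upwards [Metric.ball_mem_nhds (0 : ℂ) (show (0 : ℝ) < 1 / 4 by norm_num)] with w hw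
    simpa using (mem_ball_zero_iff.1 hw).le
  filter_upwards [nhdsWithin_le_nhds this] with w hw using h w hw

/-- The identity is known at u = w e^{-w} for small w; the identity theorem carries it to the open
disk and continuity to its boundary. -/
theorem abelSeries_eq_exp {m : ℤ} (hm : m ≠ 0) {u : ℂ} (hu : ‖u‖ ≤ Real.exp (-1)) :
    m * abelSeries m u = Complex.exp (m * treeFun u) := by
  have hb : Set.EqOn (fun u => m * abelSeries m u) (fun u => Complex.exp (m * treeFun u))
      (Metric.ball 0 (Real.exp (-1))) := by
    refine eqOn_ball_of_eq_mul_exp_neg (analyticOnNhd_const.mul (analyticOnNhd_abelSeries m))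
      (analyticOnNhd_const.mul analyticOnNhd_treeFun).cexp fun w hw => ?_
    simp only [abelSeries_mul_exp_neg hm hw, treeFun_mul_exp_neg_of_small hw]
  refine hb.of_subset_closure (continuousOn_const.mul (continuousOn_abelSeries m))
    (continuousOn_const.mul continuousOn_treeFun).cexp Metric.ball_subset_closedBall ?_
    (by simpa using hu)
  rw [closure_ball _ (Real.exp_pos _).ne']

theorem treeFun_eq_mul_exp {u : ℂ} (hu : ‖u‖ ≤ Real.exp (-1)) :
    treeFun u = u * Complex.exp (treeFun u) := by
  have h := abelSeries_eq_exp one_ne_zero hu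
  simp only [Int.cast_one, one_mul] at h
  rw [← h, treeFun]

theorem treeFun_mul_exp_neg {u : ℂ} (hu : ‖u‖ ≤ Real.exp (-1)) :
    treeFun u * Complex.exp (-treeFun u) = u := by
  nth_rewrite 1 [treeFun_eq_mul_exp hu]
  rw [mul_assoc, ← Complex.exp_add]
  simp

theorem hasSum_treeFun {u : ℂ} (hu : ‖u‖ ≤ Real.exp (-1)) :
    HasSum (fun j : ℕ => abelCoeff 0 j * u ^ j) (treeFun u) :=
  abelSeries_zero hu ▸ hasSum_abelSeries 0 hu

/-- Otherwise, by connectedness, |T(v)| = 1 for some v in the open disk, and then |v| = |T(v)|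
e^{-Re T(v)} ≥ 1/e. -/
theorem norm_treeFun_lt_one {u : ℂ} (hu : ‖u‖ < Real.exp (-1)) : ‖treeFun u‖ < 1 := by
  by_contra! h
  have hpre : IsPreconnected ((fun u => ‖treeFun u‖) '' Metric.ball 0 (Real.exp (-1))) :=
    (convex_ball _ _).isPreconnected.image _
      (continuousOn_treeFun.norm.mono Metric.ball_subset_closedBall)
  have h0 : (0 : ℝ) ∈ (fun u => ‖treeFun u‖) '' Metric.ball 0 (Real.exp (-1)) :=
    ⟨0, by simp [Real.exp_pos], by simp [treeFun]⟩
  obtain ⟨v, hv, hv1⟩ := hpre.ordConnected.out h0 ⟨u, by simpa using hu, rfl⟩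
    ⟨zero_le_one, h⟩
  simp only at hv1
  have hv' : ‖v‖ < Real.exp (-1) := by simpa using hv
  have h1 := congrArg norm (treeFun_mul_exp_neg hv'.le)
  rw [norm_mul, hv1, Complex.norm_exp, one_mul, Complex.neg_re] at h1
  have h2 : (treeFun v).re ≤ 1 := hv1 ▸ Complex.re_le_norm _
  have := Real.exp_le_exp.2 (neg_le_neg h2)
  linarith

theorem norm_treeFun_le_one {u : ℂ} (hu : ‖u‖ ≤ Real.exp (-1)) : ‖treeFun u‖ ≤ 1 := by
  have hcl : closure (Metric.ball (0 : ℂ) (Real.exp (-1))) = Metric.closedBall 0 (Real.exp (-1)) :=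
    closure_ball _ (Real.exp_pos _).ne'
  exact le_on_closure (f := fun u => ‖treeFun u‖) (g := fun _ => 1)
    (fun v hv => (norm_treeFun_lt_one (by simpa using hv)).le)
    (hcl ▸ continuousOn_treeFun.norm) continuousOn_const (hcl ▸ by simpa using hu)

/-- Analytic continuation from a neighbourhood of 0; star-shapedness supplies the connectedness. -/
theorem treeFun_mul_exp_neg_self {w : ℂ} (hw : w ∈ szegoDomain 0) :
    treeFun (w * Complex.exp (-w)) = w := by
  have hf : AnalyticOnNhd ℂ (fun w : ℂ => treeFun (w * Complex.exp (-w))) (szegoDomain 0) := by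
    refine analyticOnNhd_treeFun.comp (t := Metric.ball 0 (Real.exp (-1)))
      (analyticOnNhd_id.mul (analyticOnNhd_id.neg).cexp) fun w hw => ?_
    simpa using norm_mul_exp_neg_lt_of_mem_szegoDomain hw
  refine hf.eqOn_of_preconnected_of_eventuallyEq analyticOnNhd_id
    (isPreconnected_szegoDomain 0) (zero_mem_szegoDomain 0) ?_ hw
  filter_upwards [Metric.ball_mem_nhds (0 : ℂ) (show (0 : ℝ) < 1 / 4 by norm_num)] with w hw
  exact treeFun_mul_exp_neg_of_small (mem_ball_zero_iff.1 hw).le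

/-! ### The principal Lambert branch on the disk of radius 1/e -/

theorem mul_cot_lt_one {y : ℝ} (hy0 : 0 < y) (hy : y < Real.pi) : y * Real.cot y < 1 := by
  have hs : 0 < Real.sin y := Real.sin_pos_of_pos_of_lt_pi hy0 hy
  rw [Real.cot_eq_cos_div_sin, ← mul_div_assoc, div_lt_one hs]
  rcases lt_or_ge y (Real.pi / 2) with h | h
  · have h1 := Real.lt_tan hy0 h
    have hc : 0 < Real.cos y := Real.cos_pos_of_mem_Ioo ⟨by linarith, h⟩
    rwa [Real.tan_eq_sin_div_cos, lt_div_iff₀ hc] at h1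
  · have : Real.cos y ≤ 0 := Real.cos_nonpos_of_pi_div_two_le_of_le h (by linarith [Real.pi_pos])
    nlinarith

theorem one_sub_sq_le_mul_cot {y : ℝ} (hy0 : 0 < y) (hy : y < 1) :
    1 - y ^ 2 / 2 ≤ y * Real.cot y := by
  have hs : 0 < Real.sin y :=
    Real.sin_pos_of_pos_of_lt_pi hy0 (by linarith [Real.pi_gt_three])
  rw [Real.cot_eq_cos_div_sin, ← mul_div_assoc, le_div_iff₀ hs]
  have h1 := Real.one_sub_sq_div_two_le_cos (x := y)
  have h2 := (Real.sin_lt hy0).le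
  have h3 : 0 ≤ 1 - y ^ 2 / 2 := by nlinarith
  calc (1 - y ^ 2 / 2) * Real.sin y ≤ (1 - y ^ 2 / 2) * y := by gcongr
    _ ≤ Real.cos y * y := by gcongr
    _ = _ := mul_comm _ _

theorem neg_one_le_re_of_mem_lambertPrincipalRange {w : ℂ} (hw : w ∈ lambertPrincipalRange) :
    -1 ≤ w.re := by
  obtain ⟨h1, h2, h3, h4⟩ := hw
  rw [abs_lt] at h1
  rcases lt_trichotomy w.im 0 with h | h | h
  · have := mul_cot_lt_one (y := -w.im) (by linarith) (by linarith)
    rw [Real.cot_eq_cos_div_sin, Real.cos_neg, Real.sin_neg, div_neg, neg_mul_neg,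
      ← Real.cot_eq_cos_div_sin] at this
    linarith [h4 h]
  · exact h2 h
  · linarith [mul_cot_lt_one h h1.2, h3 h]

theorem mem_lambertPrincipalRange_of_norm_lt_one {w : ℂ} (hw : ‖w‖ < 1) :
    w ∈ lambertPrincipalRange := by
  have hre := abs_lt.1 ((Complex.abs_re_le_norm w).trans_lt hw)
  have him := abs_lt.1 ((Complex.abs_im_le_norm w).trans_lt hw)
  have hsq : w.re ^ 2 + w.im ^ 2 < 1 := by
    have := Complex.sq_norm w
    rw [Complex.normSq_apply] at this
    nlinarith [norm_nonneg w]
  -- With x = Re w and y = Im w: 0 ≤ (x+1)² = x² + 2x + 1 < 2 + 2x - y².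
  have key : -(1 - w.im ^ 2 / 2) < w.re := by
    nlinarith [sq_nonneg (w.im ^ 2), sq_nonneg (w.re + 1)]
  refine ⟨abs_lt.2 ⟨by linarith [Real.pi_gt_three], by linarith [Real.pi_gt_three]⟩,
    fun _ => hre.1.le, fun h => ?_, fun h => ?_⟩
  · linarith [one_sub_sq_le_mul_cot h him.2]
  · have := one_sub_sq_le_mul_cot (y := -w.im) (by linarith) (by linarith)
    rw [Real.cot_eq_cos_div_sin, Real.cos_neg, Real.sin_neg, div_neg, neg_mul_neg,
      ← Real.cot_eq_cos_div_sin, neg_sq] at this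
    linarith

/-- The chosen value w has Re w ≥ -1 and |w| e^{Re w} < 1/e, hence |w| < 1. So -w lies where T
inverts w e^{-w}, which makes the solution unique. -/
theorem lambertW0_eq_neg_treeFun {v : ℂ} (hv : ‖v‖ < Real.exp (-1)) :
    lambertW0 v = -treeFun (-v) := by
  have hv' : ‖-v‖ < Real.exp (-1) := by rwa [norm_neg]
  have hex : ∃ w : ℂ, w ∈ lambertPrincipalRange ∧ w * Complex.exp w = v := by
    refine ⟨-treeFun (-v), mem_lambertPrincipalRange_of_norm_lt_one ?_, ?_⟩
    · rw [norm_neg]; exact norm_treeFun_lt_one hv'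
    · rw [neg_mul, treeFun_mul_exp_neg hv'.le, neg_neg]
  obtain ⟨h1, h2⟩ := Classical.epsilon_spec hex
  change lambertW0 v ∈ _ at h1
  change lambertW0 v * Complex.exp (lambertW0 v) = v at h2
  set w := lambertW0 v
  have hre := neg_one_le_re_of_mem_lambertPrincipalRange h1
  have hn : ‖w‖ < 1 := by
    rw [← h2, norm_mul, Complex.norm_exp] at hv
    have := Real.exp_le_exp.2 hre
    by_contra! h
    nlinarith [Real.exp_pos w.re]
  have hm : -w ∈ szegoDomain 0 := by
    refine mem_szegoDomain_zero_of_norm_lt (by rwa [norm_neg]) ?_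
    rwa [neg_neg, neg_mul, norm_neg, h2]
  have := treeFun_mul_exp_neg_self hm
  rw [neg_neg, neg_mul, h2] at this
  rw [this, neg_neg]

/-! ### Interior and exterior of the curve -/

/-- The set of points with `|z| > 1` or `|z e^{1-z}| > e^{-t}`. -/
def szegoCodomain (t : ℝ) : Set ℂ :=
  {z | 1 < ‖z‖ ∨ Real.exp (-t) < ‖z * Complex.exp (1 - z)‖}

theorem isOpen_szegoCodomain (t : ℝ) : IsOpen (szegoCodomain t) := by
  have h1 : IsOpen {z : ℂ | 1 < ‖z‖} := isOpen_lt (by fun_prop) (by fun_prop)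
  have h2 : IsOpen {z : ℂ | Real.exp (-t) < ‖z * Complex.exp (1 - z)‖} :=
    isOpen_lt (by fun_prop) (by fun_prop)
  exact h1.union h2

theorem disjoint_szegoDomain_szegoCodomain (t : ℝ) :
    Disjoint (szegoDomain t) (szegoCodomain t) := by
  rw [Set.disjoint_left]
  rintro z ⟨h1, h2⟩ (h | h) <;> linarith

theorem norm_lt_one_of_norm_mul_exp_lt {t : ℝ} (ht : 0 ≤ t) {z : ℂ} (hz : ‖z‖ ≤ 1)
    (h : ‖z * Complex.exp (1 - z)‖ < Real.exp (-t)) : ‖z‖ < 1 := by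
  refine lt_of_le_of_ne hz fun h1 => ?_
  rw [norm_mul_exp_one_sub, h1, one_mul, Real.exp_lt_exp] at h
  linarith [(Complex.re_le_norm z).trans hz]

theorem szegoCurve_compl {t : ℝ} (ht : 0 ≤ t) :
    (szegoCurve t)ᶜ = szegoDomain t ∪ szegoCodomain t := by
  ext z
  simp only [szegoCurve, Set.mem_compl_iff, Set.mem_ofPred_eq, not_and, not_le, Set.mem_union,
    szegoDomain, szegoCodomain]
  constructor
  · intro h
    rcases lt_or_ge 1 ‖z‖ with h1 | h1
    · exact Or.inr (Or.inl h1)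
    rcases lt_trichotomy ‖z * Complex.exp (1 - z)‖ (Real.exp (-t)) with h2 | h2 | h2
    · exact Or.inl ⟨norm_lt_one_of_norm_mul_exp_lt ht h1 h2, h2⟩
    · exact absurd (h h2) h1.not_gt
    · exact Or.inr (Or.inr h2)
  · rintro (⟨h1, h2⟩ | h1 | h1) h
    · exact absurd h h2.ne
    · exact h1
    · exact absurd h h1.ne'

theorem smul_mem_szegoCodomain {t : ℝ} {z : ℂ} (hz : z ∈ szegoCodomain t) {s : ℝ} (hs : 1 ≤ s) :
    s • z ∈ szegoCodomain t := by
  have hs0 : 0 < s := by linarith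
  rcases lt_or_ge 1 ‖s • z‖ with h | h
  · exact Or.inl h
  rcases hz with h1 | h1
  · rw [norm_smul, Real.norm_of_nonneg hs0.le] at h
    nlinarith
  · have := norm_smul_mul_exp_le h (inv_nonneg.2 hs0.le) (inv_le_one_of_one_le₀ hs)
    rw [inv_smul_smul₀ hs0.ne'] at this
    exact Or.inr (h1.trans_le this)

theorem isBounded_szegoDomain (t : ℝ) : Bornology.IsBounded (szegoDomain t) :=
  Metric.isBounded_ball.subset (s := szegoDomain t) (t := Metric.ball 0 1) fun z hz => by
    simpa using hz.1

/-- Two disjoint open sets cover the complement of the curve, so a component cannot leave the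
bounded one. -/
theorem isBounded_component_of_mem_szegoDomain {t : ℝ} (ht : 0 ≤ t) {z : ℂ}
    (hz : z ∈ szegoDomain t) :
    Bornology.IsBounded (connectedComponentIn (szegoCurve t)ᶜ z) := by
  refine (isBounded_szegoDomain t).subset ?_
  have hzc : z ∈ (szegoCurve t)ᶜ := by rw [szegoCurve_compl ht]; exact Or.inl hz
  refine isPreconnected_connectedComponentIn.subset_left_of_subset_union
    (isOpen_szegoDomain t) (isOpen_szegoCodomain t) (disjoint_szegoDomain_szegoCodomain t)
    ?_ ⟨z, mem_connectedComponentIn hzc, hz⟩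
  rw [← szegoCurve_compl ht]
  exact connectedComponentIn_subset _ _

/-- By radial monotonicity the component contains the whole outward ray from z. -/
theorem not_isBounded_component_of_mem_szegoCodomain {t : ℝ} (ht : 0 ≤ t) {z : ℂ}
    (hz : z ∈ szegoCodomain t) :
    ¬ Bornology.IsBounded (connectedComponentIn (szegoCurve t)ᶜ z) := by
  intro hb
  have hray : (fun s : ℝ => s • z) '' Set.Ici 1 ⊆ connectedComponentIn (szegoCurve t)ᶜ z := by
    refine IsPreconnected.subset_connectedComponentIn ?_ ⟨1, by simp, by simp⟩ ?_
    · exact isPreconnected_Ici.image _ (by fun_prop)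
    · rintro _ ⟨s, hs, rfl⟩
      rw [szegoCurve_compl ht]
      exact Or.inr (smul_mem_szegoCodomain hz hs)
  have hz0 : z ≠ 0 := by
    rintro rfl
    exact Set.disjoint_left.1 (disjoint_szegoDomain_szegoCodomain t) (zero_mem_szegoDomain t) hz
  obtain ⟨C, hC⟩ := (hb.subset hray).exists_norm_le
  have hn : 0 < ‖z‖ := norm_pos_iff.2 hz0
  have h1 := hC _ ⟨max 1 ((C + 1) / ‖z‖), Set.mem_Ici.2 (le_max_left _ _), rfl⟩
  simp only at h1
  rw [norm_smul, Real.norm_of_nonneg (by positivity)] at h1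
  have h2 : (C + 1) / ‖z‖ * ‖z‖ ≤ max 1 ((C + 1) / ‖z‖) * ‖z‖ := by
    gcongr
    exact le_max_right _ _
  rw [div_mul_cancel₀ _ hn.ne'] at h2
  linarith

theorem curveInterior_szegoCurve {t : ℝ} (ht : 0 ≤ t) :
    curveInterior (szegoCurve t) = szegoDomain t := by
  ext z
  constructor
  · rintro ⟨h1, h2⟩
    rcases (szegoCurve_compl ht ▸ h1 : z ∈ szegoDomain t ∪ szegoCodomain t) with h | h
    · exact h
    · exact absurd h2 (not_isBounded_component_of_mem_szegoCodomain ht h)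
  · intro h
    exact ⟨(szegoCurve_compl ht ▸ Or.inl h : z ∈ (szegoCurve t)ᶜ),
      isBounded_component_of_mem_szegoDomain ht h⟩

theorem curveExterior_szegoCurve {t : ℝ} (ht : 0 ≤ t) :
    curveExterior (szegoCurve t) = szegoCodomain t := by
  ext z
  constructor
  · rintro ⟨h1, h2⟩
    rcases (szegoCurve_compl ht ▸ h1 : z ∈ szegoDomain t ∪ szegoCodomain t) with h | h
    · exact absurd (isBounded_component_of_mem_szegoDomain ht h) h2
    · exact h
  · intro h
    exact ⟨(szegoCurve_compl ht ▸ Or.inr h : z ∈ (szegoCurve t)ᶜ),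
      not_isBounded_component_of_mem_szegoCodomain ht h⟩

/-! ### The Schwarz function -/

/-- The argument `e^{-2(t+1)} e^z / z` of the tree function in `S(z,t)`. -/
def schwarzArg (t : ℝ) (z : ℂ) : ℂ := Complex.exp (-2 * ((t : ℂ) + 1)) * z⁻¹ * Complex.exp z

theorem norm_schwarzArg (t : ℝ) (z : ℂ) :
    ‖schwarzArg t z‖ = Real.exp (-2 * (t + 1)) * ‖z‖⁻¹ * Real.exp z.re := by
  simp [schwarzArg, Complex.norm_exp]

theorem schwarzS_eq_treeFun {t : ℝ} {z : ℂ} (h : ‖schwarzArg t z‖ < Real.exp (-1)) :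
    schwarzS t z = treeFun (schwarzArg t z) := by
  rw [schwarzS, ← schwarzArg, lambertW0_eq_neg_treeFun (by rwa [norm_neg]), neg_neg, neg_neg]

theorem norm_eq_of_mem_szegoCurve {t : ℝ} {z : ℂ} (hz : z ∈ szegoCurve t) :
    ‖z‖ = Real.exp (z.re - 1 - t) := by
  have h := hz.1
  rw [norm_mul_exp_one_sub] at h
  calc ‖z‖ = ‖z‖ * Real.exp (1 - z.re) * Real.exp (z.re - 1) := by
        rw [mul_assoc, ← Real.exp_add]; simp
    _ = _ := by rw [h, ← Real.exp_add]; ring_nf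

theorem ne_zero_of_mem_szegoCurve {t : ℝ} {z : ℂ} (hz : z ∈ szegoCurve t) : z ≠ 0 := by
  rw [← norm_pos_iff, norm_eq_of_mem_szegoCurve hz]
  exact Real.exp_pos _

theorem norm_schwarzArg_of_mem_szegoCurve {t : ℝ} (ht : 0 < t) {z : ℂ} (hz : z ∈ szegoCurve t) :
    ‖schwarzArg t z‖ < Real.exp (-1) := by
  rw [norm_schwarzArg, norm_eq_of_mem_szegoCurve hz, ← Real.exp_neg, ← Real.exp_add,
    ← Real.exp_add]
  apply Real.exp_lt_exp.2
  linarith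

/-- Substituting z̄ = |z|²/z and e^z = e^{2 Re z} e^{-z̄} leaves the common factor e^{-z̄}/z on both
sides. -/
theorem conj_mul_exp_neg_eq_schwarzArg_iff {t : ℝ} {z : ℂ} (hz : z ≠ 0) :
    (starRingEnd ℂ) z * Complex.exp (-(starRingEnd ℂ) z) = schwarzArg t z ↔
      ‖z‖ = Real.exp (z.re - 1 - t) := by
  have h1 : (starRingEnd ℂ) z * Complex.exp (-(starRingEnd ℂ) z) = schwarzArg t z ↔
      ((‖z‖ ^ 2 : ℝ) : ℂ) = ((Real.exp (z.re - 1 - t) ^ 2 : ℝ) : ℂ) := by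
    have e1 : (starRingEnd ℂ) z = ((‖z‖ ^ 2 : ℝ) : ℂ) / z := by
      rw [eq_div_iff hz, mul_comm, Complex.mul_conj, Complex.normSq_eq_norm_sq]
    have e2 : schwarzArg t z = ((Real.exp (z.re - 1 - t) ^ 2 : ℝ) : ℂ) / z *
        Complex.exp (-(starRingEnd ℂ) z) := by
      rw [schwarzArg, ← Real.exp_nat_mul, Complex.ofReal_exp, div_eq_mul_inv, mul_right_comm,
        ← Complex.exp_add, mul_right_comm, ← Complex.exp_add]
      congr 2
      have := Complex.add_conj z
      push_cast at this ⊢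
      linear_combination this
    rw [e2]
    nth_rewrite 1 [e1]
    rw [mul_left_inj' (Complex.exp_ne_zero _), div_left_inj' hz]
  rw [h1, Complex.ofReal_inj, sq_eq_sq₀ (norm_nonneg _) (Real.exp_pos _).le]

theorem conj_mem_szegoDomain {t : ℝ} (ht : 0 < t) {z : ℂ} (hz : z ∈ szegoCurve t) :
    (starRingEnd ℂ) z ∈ szegoDomain 0 := by
  have h : ‖z * Complex.exp (1 - z)‖ < Real.exp (-0) := by
    rw [hz.1]; apply Real.exp_lt_exp.2; linarith
  have h2 := norm_lt_one_of_norm_mul_exp_lt le_rfl hz.2 h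
  refine ⟨by rwa [Complex.norm_conj], ?_⟩
  rw [norm_mul_exp_one_sub] at h ⊢
  simpa using h

theorem conj_eq_schwarzS_iff {t : ℝ} (ht : 0 < t) {z : ℂ} (hz : z ≠ 0)
    (h : ‖schwarzArg t z‖ < Real.exp (-1)) :
    (starRingEnd ℂ) z = schwarzS t z ↔ z ∈ szegoCurve t := by
  rw [schwarzS_eq_treeFun h]
  constructor
  · intro h1
    have h2 : ‖z‖ < 1 := by
      rw [← Complex.norm_conj, h1]; exact norm_treeFun_lt_one h
    have h3 := treeFun_mul_exp_neg h.le
    rw [← h1, conj_mul_exp_neg_eq_schwarzArg_iff hz] at h3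
    refine ⟨?_, h2.le⟩
    rw [norm_mul_exp_one_sub, h3, ← Real.exp_add]
    ring_nf
  · intro h1
    have h2 := (conj_mul_exp_neg_eq_schwarzArg_iff hz).2 (norm_eq_of_mem_szegoCurve h1)
    rw [← h2, treeFun_mul_exp_neg_self (conj_mem_szegoDomain ht h1)]

/-! ### The radii of the annulus -/

theorem exp_div_eq_iff {t x : ℝ} :
    Real.exp x / x = Real.exp (2 * t + 1) ↔ Real.exp x = Real.exp (2 * t + 1) * x := by
  rcases eq_or_ne x 0 with rfl | hx
  -- At x = 0 both sides are false, since division by zero gives 0.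
  · simp [(Real.exp_pos _).ne]
  · rw [div_eq_iff hx]

theorem pos_of_exp_eq_mul {t x : ℝ} (h : Real.exp x = Real.exp (2 * t + 1) * x) : 0 < x :=
  pos_of_mul_pos_right (h ▸ Real.exp_pos x) (Real.exp_pos _).le

/-- A crude bound from e^x ≥ 1 + x + x²/2; it keeps the supremum defining the outer radius finite.
-/
theorem le_of_exp_eq_mul {t x : ℝ} (h : Real.exp x = Real.exp (2 * t + 1) * x) :
    x ≤ 2 * Real.exp (2 * t + 1) := by
  have hx := pos_of_exp_eq_mul h
  have h1 := Real.quadratic_le_exp_of_nonneg hx.le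
  by_contra! h2
  nlinarith

theorem isClosed_exp_eq_mul (t : ℝ) :
    IsClosed {x : ℝ | Real.exp x / x = Real.exp (2 * t + 1)} := by
  simp only [exp_div_eq_iff]
  exact isClosed_eq (by fun_prop) (by fun_prop)

theorem bddBelow_exp_eq_mul (t : ℝ) :
    BddBelow {x : ℝ | Real.exp x / x = Real.exp (2 * t + 1)} :=
  ⟨0, fun _ hx => (pos_of_exp_eq_mul (exp_div_eq_iff.1 hx)).le⟩

theorem bddAbove_exp_eq_mul (t : ℝ) :
    BddAbove {x : ℝ | Real.exp x / x = Real.exp (2 * t + 1)} :=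
  ⟨_, fun _ hx => le_of_exp_eq_mul (exp_div_eq_iff.1 hx)⟩

theorem exp_one_lt_exp {t : ℝ} (ht : 0 < t) : Real.exp 1 < Real.exp (2 * t + 1) :=
  Real.exp_lt_exp.2 (by linarith)

theorem exists_exp_eq_mul_lt_one {t : ℝ} (ht : 0 < t) :
    ∃ x, x < 1 ∧ Real.exp x / x = Real.exp (2 * t + 1) := by
  obtain ⟨x, hx, h⟩ := intermediate_value_Icc' (zero_le_one (α := ℝ))
    (f := fun x => Real.exp x - Real.exp (2 * t + 1) * x) (by fun_prop)
    (show (0 : ℝ) ∈ Set.Icc _ _ by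
      simpa using (exp_one_lt_exp ht).le)
  have h' : Real.exp x = Real.exp (2 * t + 1) * x := sub_eq_zero.1 h
  refine ⟨x, lt_of_le_of_ne hx.2 ?_, exp_div_eq_iff.2 h'⟩
  rintro rfl
  exact (exp_one_lt_exp ht).ne (by simpa using h')

theorem exists_exp_eq_mul_gt_one {t : ℝ} (ht : 0 < t) :
    ∃ x, 1 < x ∧ Real.exp x / x = Real.exp (2 * t + 1) := by
  have ha : 1 < Real.exp (2 * t + 1) := Real.one_lt_exp_iff.2 (by linarith)
  obtain ⟨x, hx, h⟩ := intermediate_value_Icc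
    (show (1 : ℝ) ≤ 2 * Real.exp (2 * t + 1) by linarith)
    (f := fun x => Real.exp x - Real.exp (2 * t + 1) * x) (by fun_prop)
    (show (0 : ℝ) ∈ Set.Icc _ _ by
      constructor
      · simpa using (exp_one_lt_exp ht).le
      · have := Real.quadratic_le_exp_of_nonneg
          (show 0 ≤ 2 * Real.exp (2 * t + 1) by positivity)
        nlinarith)
  have h' : Real.exp x = Real.exp (2 * t + 1) * x := sub_eq_zero.1 h
  refine ⟨x, lt_of_le_of_ne hx.1 ?_, exp_div_eq_iff.2 h'⟩
  rintro rfl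
  exact (exp_one_lt_exp ht).ne (by simpa using h')

theorem innerRadius_mem {t : ℝ} (ht : 0 < t) :
    Real.exp (innerRadius t) = Real.exp (2 * t + 1) * innerRadius t := by
  obtain ⟨x, -, hx⟩ := exists_exp_eq_mul_lt_one ht
  exact exp_div_eq_iff.1 ((isClosed_exp_eq_mul t).csInf_mem ⟨x, hx⟩ (bddBelow_exp_eq_mul t))

theorem outerRadius_mem {t : ℝ} (ht : 0 < t) :
    Real.exp (outerRadius t) = Real.exp (2 * t + 1) * outerRadius t := by
  obtain ⟨x, -, hx⟩ := exists_exp_eq_mul_lt_one ht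
  exact exp_div_eq_iff.1 ((isClosed_exp_eq_mul t).csSup_mem ⟨x, hx⟩ (bddAbove_exp_eq_mul t))

theorem innerRadius_pos {t : ℝ} (ht : 0 < t) : 0 < innerRadius t :=
  pos_of_exp_eq_mul (innerRadius_mem ht)

theorem innerRadius_lt_one {t : ℝ} (ht : 0 < t) : innerRadius t < 1 := by
  obtain ⟨x, hx1, hx⟩ := exists_exp_eq_mul_lt_one ht
  exact (csInf_le (bddBelow_exp_eq_mul t) hx).trans_lt hx1

theorem one_lt_outerRadius {t : ℝ} (ht : 0 < t) : 1 < outerRadius t := by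
  obtain ⟨x, hx1, hx⟩ := exists_exp_eq_mul_gt_one ht
  exact hx1.trans_le (le_csSup (bddAbove_exp_eq_mul t) hx)

/-- Between its two intersections with the line e^{2t+1} x, the strictly convex exponential lies
below its chord. -/
theorem exp_lt_mul_of_mem_Ioo {t r : ℝ} (ht : 0 < t) (h1 : innerRadius t < r)
    (h2 : r < outerRadius t) : Real.exp r < Real.exp (2 * t + 1) * r := by
  have hd : 0 < outerRadius t - innerRadius t := by linarith
  have := strictConvexOn_exp.2 (Set.mem_univ (innerRadius t)) (Set.mem_univ (outerRadius t))
    (by linarith) (div_pos (sub_pos.2 h2) hd) (div_pos (sub_pos.2 h1) hd)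
    (by field_simp; ring)
  simp only [smul_eq_mul, innerRadius_mem ht, outerRadius_mem ht] at this
  have e : (outerRadius t - r) / (outerRadius t - innerRadius t) * innerRadius t +
      (r - innerRadius t) / (outerRadius t - innerRadius t) * outerRadius t = r := by
    field_simp; ring
  rw [e] at this
  calc Real.exp r < _ := this
    _ = Real.exp (2 * t + 1) *
      ((outerRadius t - r) / (outerRadius t - innerRadius t) * innerRadius t +
      (r - innerRadius t) / (outerRadius t - innerRadius t) * outerRadius t) := by ring
    _ = _ := by rw [e]

theorem majorant_lt_of_mem_laurentAnnulus {t : ℝ} (ht : 0 < t) {z : ℂ}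
    (hz : z ∈ laurentAnnulus t) :
    Real.exp (-2 * (t + 1)) * ‖z‖⁻¹ * Real.exp ‖z‖ < Real.exp (-1) := by
  have hz0 : 0 < ‖z‖ := (innerRadius_pos ht).trans hz.1
  have h := exp_lt_mul_of_mem_Ioo ht hz.1 hz.2
  calc Real.exp (-2 * (t + 1)) * ‖z‖⁻¹ * Real.exp ‖z‖
      < Real.exp (-2 * (t + 1)) * ‖z‖⁻¹ * (Real.exp (2 * t + 1) * ‖z‖) := by gcongr
    _ = Real.exp (-2 * (t + 1)) * Real.exp (2 * t + 1) := by field_simp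
    _ = _ := by rw [← Real.exp_add]; ring_nf

theorem ne_zero_of_mem_laurentAnnulus {t : ℝ} (ht : 0 < t) {z : ℂ}
    (hz : z ∈ laurentAnnulus t) : z ≠ 0 :=
  norm_pos_iff.1 ((innerRadius_pos ht).trans hz.1)

theorem ne_zero_and_norm_schwarzArg_lt {t : ℝ} (ht : 0 < t) {z : ℂ}
    (hz : z ∈ szegoCurve t ∪ laurentAnnulus t) :
    z ≠ 0 ∧ ‖schwarzArg t z‖ < Real.exp (-1) := by
  rcases hz with hz | hz
  · exact ⟨ne_zero_of_mem_szegoCurve hz, norm_schwarzArg_of_mem_szegoCurve ht hz⟩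
  · refine ⟨ne_zero_of_mem_laurentAnnulus ht hz,
      lt_of_le_of_lt ?_ (majorant_lt_of_mem_laurentAnnulus ht hz)⟩
    rw [norm_schwarzArg]
    gcongr
    exact Complex.re_le_norm z

theorem analyticAt_schwarzArg (t : ℝ) {z : ℂ} (hz : z ≠ 0) : AnalyticAt ℂ (schwarzArg t) z :=
  (analyticAt_const.mul (analyticAt_inv hz)).mul analyticAt_cexp

theorem analyticAt_schwarzS {t : ℝ} {z : ℂ} (hz : z ≠ 0)
    (h : ‖schwarzArg t z‖ < Real.exp (-1)) : AnalyticAt ℂ (schwarzS t) z := by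
  have ha := analyticAt_schwarzArg t hz
  have hc : AnalyticAt ℂ (fun w => treeFun (schwarzArg t w)) z :=
    (analyticOnNhd_treeFun _ (by simpa using h)).comp ha
  refine hc.congr ?_
  filter_upwards [ha.continuousAt.norm.eventually_lt_const h] with w hw
  exact (schwarzS_eq_treeFun hw).symm

/-! ### The polar equation of the curve -/

theorem ofReal_re_treeFun {x : ℝ} (hx : |x| ≤ Real.exp (-1)) :
    ((treeFun (x : ℂ)).re : ℂ) = treeFun (x : ℂ) := by
  rw [← Complex.conj_eq_iff_re]
  have h := hasSum_treeFun (u := (x : ℂ)) (by simpa using hx)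
  refine HasSum.unique ?_ h
  refine (Complex.hasSum_conj'.2 h).congr_fun fun j => ?_
  simp [abelCoeff]

/-- The value of the tree function at `cos θ e^{-(1+t)}`. -/
def szegoPhase (t θ : ℝ) : ℝ := (treeFun ((Real.cos θ * Real.exp (-(1 + t)) : ℝ) : ℂ)).re

/-- The polar radius of `γ_t` in the direction `θ`. -/
def szegoRadius (t θ : ℝ) : ℝ := Real.exp (szegoPhase t θ - (1 + t))

theorem abs_cos_mul_exp_le {t : ℝ} (ht : 0 ≤ t) (θ : ℝ) :
    |Real.cos θ * Real.exp (-(1 + t))| ≤ Real.exp (-1) := by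
  rw [abs_mul, abs_of_pos (Real.exp_pos _)]
  calc |Real.cos θ| * Real.exp (-(1 + t)) ≤ 1 * Real.exp (-(1 + t)) := by
        gcongr; exact Real.abs_cos_le_one θ
    _ ≤ _ := by rw [one_mul]; apply Real.exp_le_exp.2; linarith

theorem norm_cos_mul_exp_le {t : ℝ} (ht : 0 ≤ t) (θ : ℝ) :
    ‖((Real.cos θ * Real.exp (-(1 + t)) : ℝ) : ℂ)‖ ≤ Real.exp (-1) := by
  rw [Complex.norm_real]; exact abs_cos_mul_exp_le ht θ

theorem ofReal_szegoPhase {t : ℝ} (ht : 0 ≤ t) (θ : ℝ) :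
    (szegoPhase t θ : ℂ) = treeFun ((Real.cos θ * Real.exp (-(1 + t)) : ℝ) : ℂ) :=
  ofReal_re_treeFun (abs_cos_mul_exp_le ht θ)

/-- This is T = u e^T at u = cos θ e^{-(1+t)}, the factor e^{T-(1+t)} being the radius. -/
theorem szegoPhase_eq {t : ℝ} (ht : 0 ≤ t) (θ : ℝ) :
    szegoPhase t θ = szegoRadius t θ * Real.cos θ := by
  have h := treeFun_eq_mul_exp (norm_cos_mul_exp_le ht θ)
  rw [← ofReal_szegoPhase ht θ, ← Complex.ofReal_exp, ← Complex.ofReal_mul,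
    Complex.ofReal_inj] at h
  rw [szegoRadius, sub_eq_add_neg, Real.exp_add]
  linear_combination h

theorem szegoPhase_le_one {t : ℝ} (ht : 0 ≤ t) (θ : ℝ) : |szegoPhase t θ| ≤ 1 :=
  (Complex.abs_re_le_norm _).trans (norm_treeFun_le_one (norm_cos_mul_exp_le ht θ))

theorem szegoRadius_pos (t θ : ℝ) : 0 < szegoRadius t θ := Real.exp_pos _

theorem szegoRadius_le_one {t : ℝ} (ht : 0 ≤ t) (θ : ℝ) : szegoRadius t θ ≤ 1 := by
  apply Real.exp_le_one_iff.2
  linarith [(abs_le.1 (szegoPhase_le_one ht θ)).2]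

theorem szegoRadius_mul_exp {t : ℝ} (ht : 0 ≤ t) (θ : ℝ) :
    szegoRadius t θ * Real.exp (1 - szegoRadius t θ * Real.cos θ) = Real.exp (-t) := by
  rw [← szegoPhase_eq ht, szegoRadius, ← Real.exp_add]
  ring_nf

/-- The strict inequality r/s < e^{r/s-1} ensures that each ray meets the curve only once, even for
c = 1 and s = 1, which occurs at t = 0. -/
theorem mul_exp_one_sub_lt {r s c : ℝ} (hr : 0 < r) (hrs : r < s) (hs : s ≤ 1) (hc : c ≤ 1) :
    r * Real.exp (1 - r * c) < s * Real.exp (1 - s * c) := by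
  have hs0 : 0 < s := hr.trans hrs
  have h1 : r / s - 1 ≠ 0 := by
    rw [sub_ne_zero, Ne, div_eq_one_iff_eq hs0.ne']; exact hrs.ne
  have h2 : r / s < Real.exp (r / s - 1) := by linarith [Real.add_one_lt_exp h1]
  have h3 : r < s * Real.exp ((r - s) * c) := by
    calc r = s * (r / s) := by field_simp
      _ < s * Real.exp (r / s - 1) := by gcongr
      _ ≤ s * Real.exp ((r - s) * c) := by
          gcongr
          rw [div_sub_one hs0.ne', div_le_iff₀ hs0]
          have : s * c ≤ 1 := by nlinarith
          nlinarith
  calc r * Real.exp (1 - r * c) < s * Real.exp ((r - s) * c) * Real.exp (1 - r * c) := by gcongr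
    _ = _ := by rw [mul_assoc, ← Real.exp_add]; ring_nf

/-- The point with polar coordinates `(r, θ)`. -/
def polarPoint (r θ : ℝ) : ℂ := r * Complex.exp (θ * Complex.I)

theorem norm_polarPoint {r : ℝ} (hr : 0 < r) (θ : ℝ) : ‖polarPoint r θ‖ = r := by
  rw [polarPoint, norm_mul, Complex.norm_exp_ofReal_mul_I, Complex.norm_real, mul_one,
    Real.norm_of_nonneg hr.le]

theorem re_polarPoint (r θ : ℝ) : (polarPoint r θ).re = r * Real.cos θ := by
  rw [polarPoint, Complex.re_ofReal_mul, Complex.exp_ofReal_mul_I_re]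

theorem polarPoint_mem_szegoDomain_iff {t : ℝ} (ht : 0 ≤ t) {r : ℝ} (hr : 0 < r) (θ : ℝ) :
    polarPoint r θ ∈ szegoDomain t ↔ r < szegoRadius t θ := by
  have hρ := szegoRadius_le_one ht θ
  rw [szegoDomain, Set.mem_ofPred_eq, norm_mul_exp_one_sub, norm_polarPoint hr, re_polarPoint,
    ← szegoRadius_mul_exp ht θ]
  constructor
  · rintro ⟨h1, h2⟩
    by_contra! h
    rcases h.eq_or_lt with h | h
    · rw [h] at h2; exact h2.false
    · exact (mul_exp_one_sub_lt (szegoRadius_pos t θ) h h1.le (Real.cos_le_one θ)).not_gt h2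
  · intro h
    exact ⟨h.trans_le hρ, mul_exp_one_sub_lt hr h hρ (Real.cos_le_one θ)⟩

theorem polarPoint_mem_szegoCodomain_iff {t : ℝ} (ht : 0 ≤ t) {r : ℝ} (hr : 0 < r) (θ : ℝ) :
    polarPoint r θ ∈ szegoCodomain t ↔ szegoRadius t θ < r := by
  have hρ := szegoRadius_le_one ht θ
  rw [szegoCodomain, Set.mem_ofPred_eq, norm_mul_exp_one_sub, norm_polarPoint hr, re_polarPoint,
    ← szegoRadius_mul_exp ht θ]
  constructor
  · rintro (h1 | h2)
    · exact hρ.trans_lt h1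
    · by_contra! h
      rcases h.eq_or_lt with h | h
      · rw [← h] at h2; exact h2.false
      · exact (mul_exp_one_sub_lt hr h hρ (Real.cos_le_one θ)).not_gt h2
  · intro h
    rcases lt_or_ge 1 r with h1 | h1
    · exact Or.inl h1
    · exact Or.inr (mul_exp_one_sub_lt (szegoRadius_pos t θ) h h1 (Real.cos_le_one θ))

/-! ### Integrals in polar coordinates -/

open MeasureTheory

theorem polarCoord_symm_eq_polarPoint (p : ℝ × ℝ) :
    Complex.polarCoord.symm p = polarPoint p.1 p.2 := by
  rw [Complex.polarCoord_symm_apply, polarPoint, Complex.exp_mul_I]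
  push_cast; rfl

theorem measurable_polarPoint : Measurable fun p : ℝ × ℝ => polarPoint p.1 p.2 := by
  unfold polarPoint; fun_prop

/-- Supplies the integrability hypothesis of Fubini; finiteness comes from the polar change of
variables for the norm. -/
theorem integrable_polarPoint {g : ℂ → ℂ} (hm : Measurable g) (hg : Integrable g) :
    Integrable (fun p : ℝ × ℝ => p.1 • g (polarPoint p.1 p.2))
      ((volume.restrict (Set.Ioi 0)).prod (volume.restrict (Set.Ioo (-Real.pi) Real.pi))) := by
  rw [Measure.prod_restrict, ← Measure.volume_eq_prod]
  refine ⟨(measurable_fst.smul (hm.comp measurable_polarPoint)).aestronglyMeasurable, ?_⟩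
  have h := Complex.lintegral_comp_polarCoord_symm (fun z => ‖g z‖ₑ)
  have hfin := hg.2
  rw [HasFiniteIntegral, ← h] at hfin
  refine lt_of_eq_of_lt ?_ hfin
  refine setLIntegral_congr_fun polarCoord.open_target.measurableSet fun p hp => ?_
  have hp0 : 0 < p.1 := hp.1
  simp only [polarCoord_symm_eq_polarPoint, enorm_smul, smul_eq_mul]
  rw [Real.enorm_of_nonneg hp0.le]

/-- The integral of `z^n` over the region `a(θ) < r < b(θ)` in polar coordinates. -/
theorem setIntegral_zpow_polar {A : Set ℂ} (hA : MeasurableSet A) {a b : ℝ → ℝ} {n : ℤ}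
    (hint : IntegrableOn (fun z : ℂ => z ^ n) A)
    (hab : ∀ θ, 0 ≤ a θ ∧ a θ ≤ b θ)
    (hmem : ∀ r θ, 0 < r → (polarPoint r θ ∈ A ↔ a θ < r ∧ r < b θ)) :
    ∫ z in A, z ^ n = ∫ θ in -Real.pi..Real.pi,
      Complex.exp (n * (θ * Complex.I)) * ((∫ r in a θ..b θ, r ^ (n + 1) : ℝ) : ℂ) := by
  have hm : Measurable (A.indicator fun z : ℂ => z ^ n) :=
    (show Measurable fun z : ℂ => z ^ n by fun_prop).indicator hA
  have hg : Integrable (A.indicator fun z : ℂ => z ^ n) := (integrable_indicator_iff hA).2 hint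
  rw [← integral_indicator hA, ← Complex.integral_comp_polarCoord_symm]
  simp only [polarCoord_symm_eq_polarPoint]
  have hpi : -Real.pi ≤ Real.pi := by linarith [Real.pi_pos]
  rw [show polarCoord.target = Set.Ioi (0 : ℝ) ×ˢ Set.Ioo (-Real.pi) Real.pi from rfl,
    Measure.volume_eq_prod, ← Measure.prod_restrict,
    integral_prod_symm _ (integrable_polarPoint hm hg),
    intervalIntegral.integral_of_le hpi, integral_Ioc_eq_integral_Ioo]
  refine integral_congr_ae (Filter.Eventually.of_forall fun θ => ?_)
  obtain ⟨h0, h1⟩ := hab θ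
  have h2 : ∫ r in Set.Ioi (0 : ℝ), r • A.indicator (fun z : ℂ => z ^ n) (polarPoint r θ) =
      ∫ r in Set.Ioi (0 : ℝ), (Set.Ioo (a θ) (b θ)).indicator
        (fun r : ℝ => Complex.exp (n * (θ * Complex.I)) * ((r ^ (n + 1) : ℝ) : ℂ)) r := by
    refine setIntegral_congr_fun measurableSet_Ioi fun r hr => ?_
    have hr0 : (0 : ℝ) < r := hr
    have hrc : (r : ℂ) ≠ 0 := by exact_mod_cast hr0.ne'
    by_cases h : a θ < r ∧ r < b θ
    · have hA' : polarPoint r θ ∈ A := (hmem r θ hr0).2 h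
      rw [Set.indicator_of_mem hA', Set.indicator_of_mem (show r ∈ Set.Ioo (a θ) (b θ) from h),
        polarPoint, Complex.real_smul, mul_zpow, ← Complex.exp_int_mul, Complex.ofReal_zpow, zpow_add_one₀ hrc]
      ring
    · have hA' : polarPoint r θ ∉ A := fun h' => h ((hmem r θ hr0).1 h')
      simp only [Set.indicator_of_notMem hA',
        Set.indicator_of_notMem (show r ∉ Set.Ioo (a θ) (b θ) from h), smul_zero]
  have h3 : Set.Ioi 0 ∩ Set.Ioo (a θ) (b θ) = Set.Ioo (a θ) (b θ) :=
    Set.inter_eq_right.2 fun r hr => Set.mem_Ioi.2 (h0.trans_lt hr.1)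
  dsimp only
  rw [h2, setIntegral_indicator measurableSet_Ioo, h3, ← integral_Ioc_eq_integral_Ioo,
    ← intervalIntegral.integral_of_le h1, intervalIntegral.integral_const_mul,
    intervalIntegral.integral_ofReal]

/-! ### Integrability, and the moments as Fourier integrals -/

theorem integrableOn_zpow_szegoDomain (t : ℝ) {n : ℤ} (hn : 0 ≤ n) :
    IntegrableOn (fun z : ℂ => z ^ n) (szegoDomain t) := by
  obtain ⟨n, rfl⟩ := Int.eq_ofNat_of_zero_le hn
  refine Measure.integrableOn_of_bounded (M := 1) (isBounded_szegoDomain t).measure_lt_top.ne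
    (by fun_prop) ?_
  filter_upwards [ae_restrict_mem (isOpen_szegoDomain t).measurableSet] with z hz
  rw [zpow_natCast, norm_pow]
  exact pow_le_one₀ (norm_nonneg z) hz.1.le

theorem le_norm_of_mem_szegoCodomain {t : ℝ} (ht : 0 ≤ t) {z : ℂ} (hz : z ∈ szegoCodomain t) :
    Real.exp (-(2 + t)) ≤ ‖z‖ := by
  by_contra! h
  have h1 : Real.exp (-(2 + t)) ≤ 1 := Real.exp_le_one_iff.2 (by linarith)
  rcases hz with h2 | h2
  · linarith
  · rw [norm_mul_exp_one_sub] at h2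
    have h3 := (abs_le.1 (Complex.abs_re_le_norm z)).1
    have h4 : ‖z‖ * Real.exp (1 - z.re) ≤ Real.exp (-(2 + t)) * Real.exp 2 := by
      gcongr
      linarith
    rw [← Real.exp_add] at h4
    ring_nf at h4 h2
    linarith

theorem integrableOn_zpow_szegoCodomain_ball {t : ℝ} (ht : 0 ≤ t) {k : ℤ} (hk : 1 ≤ k) (R : ℝ) :
    IntegrableOn (fun z : ℂ => z ^ (-k)) (szegoCodomain t ∩ Metric.ball 0 R) := by
  obtain ⟨k, rfl⟩ := Int.eq_ofNat_of_zero_le (by omega : 0 ≤ k)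
  refine Measure.integrableOn_of_bounded (M := (Real.exp (-(2 + t)) ^ k)⁻¹)
    (Metric.isBounded_ball.subset Set.inter_subset_right).measure_lt_top.ne
    (by fun_prop) ?_
  filter_upwards [ae_restrict_mem
    ((isOpen_szegoCodomain t).inter Metric.isOpen_ball).measurableSet] with z hz
  rw [zpow_neg, zpow_natCast, norm_inv, norm_pow]
  have := le_norm_of_mem_szegoCodomain ht hz.1
  gcongr

theorem integrableOn_zpow_szegoCodomain {t : ℝ} (ht : 0 ≤ t) {k : ℤ} (hk : 3 ≤ k) :
    IntegrableOn (fun z : ℂ => z ^ (-k)) (szegoCodomain t) := by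
  obtain ⟨k, rfl⟩ : ∃ j : ℕ, k = j + 3 := ⟨(k - 3).toNat, by omega⟩
  set δ := Real.exp (-(2 + t)) with hδ
  have hδ0 : 0 < δ := Real.exp_pos _
  have hi : Integrable (fun z : ℂ => (δ ^ k)⁻¹ * (1 + δ⁻¹) ^ 3 * (1 + ‖z‖) ^ (-(3 : ℝ))) :=
    -- The exponent 3 exceeds the real dimension 2 of the plane.
    (integrable_one_add_norm (by simp [Complex.finrank_real_complex]; norm_num)).const_mul _
  refine hi.integrableOn.mono' (by fun_prop) ?_
  filter_upwards [ae_restrict_mem (isOpen_szegoCodomain t).measurableSet] with z hz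
  have hz' : δ ≤ ‖z‖ := le_norm_of_mem_szegoCodomain ht hz
  have hz0 : 0 < ‖z‖ := hδ0.trans_le hz'
  rw [zpow_neg, show ((k : ℤ) + 3) = ((k + 3 : ℕ) : ℤ) by push_cast; rfl, zpow_natCast, norm_inv,
    norm_pow, pow_add, Real.rpow_neg (by positivity), mul_inv,
    show (1 + ‖z‖) ^ (3 : ℝ) = (1 + ‖z‖) ^ 3 by exact_mod_cast Real.rpow_natCast (1 + ‖z‖) 3,
    mul_assoc]
  have h1 : 1 + ‖z‖ ≤ (1 + δ⁻¹) * ‖z‖ := by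
    have : 1 ≤ δ⁻¹ * ‖z‖ := by rw [inv_mul_eq_div, one_le_div hδ0]; exact hz'
    linarith
  have h2 : (‖z‖ ^ 3)⁻¹ ≤ (1 + δ⁻¹) ^ 3 * ((1 + ‖z‖) ^ 3)⁻¹ := by
    rw [← div_eq_mul_inv, le_div_iff₀ (by positivity), inv_mul_le_iff₀ (by positivity), mul_comm,
      ← mul_pow]
    gcongr
  gcongr

/-- An antiderivative of `r^{m-1}` for `r > 0`. -/
def powPrimitive (m : ℤ) (r : ℝ) : ℝ := if m = 0 then Real.log r else r ^ m / m

theorem integral_zpow_eq_powPrimitive {a b : ℝ} (ha : 0 < a) (hb : 0 < b) (m : ℤ) :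
    ∫ r in a..b, r ^ (m - 1) = powPrimitive m b - powPrimitive m a := by
  have h0 : (0 : ℝ) ∉ Set.uIcc a b := Set.notMem_uIcc_of_lt ha hb
  rcases eq_or_ne m 0 with rfl | hm
  · simp only [powPrimitive, if_true, zero_sub, zpow_neg_one]
    rw [integral_inv_of_pos ha hb, Real.log_div hb.ne' ha.ne']
  · rw [integral_zpow (Or.inr ⟨by omega, h0⟩)]
    simp [powPrimitive, hm, sub_div]

/-- The Abel identity with r = e^{T-(1+t)}. The logarithm fits the same pattern because the series
for m = 0 is T, apart from an additive constant. -/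
theorem powPrimitive_szegoRadius {t : ℝ} (ht : 0 ≤ t) (m : ℤ) (θ : ℝ) :
    (powPrimitive m (szegoRadius t θ) : ℂ) =
      Complex.exp (-((1 + t) * m)) *
        abelSeries m ((Real.cos θ * Real.exp (-(1 + t)) : ℝ) : ℂ) +
      if m = 0 then -(1 + t : ℂ) else 0 := by
  have hu := norm_cos_mul_exp_le ht θ
  rcases eq_or_ne m 0 with rfl | hm
  · rw [abelSeries_zero hu, ← ofReal_szegoPhase ht]
    simp only [powPrimitive, if_true, szegoRadius, Real.log_exp]
    push_cast
    simp [sub_eq_add_neg]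
  · have hm' : (m : ℂ) ≠ 0 := by exact_mod_cast hm
    have h := abelSeries_eq_exp hm hu
    rw [← ofReal_szegoPhase ht] at h
    simp only [powPrimitive, hm, if_false, szegoRadius, add_zero]
    rw [← mul_right_inj' hm', mul_left_comm, h, ← Complex.exp_add]
    push_cast
    rw [mul_div_cancel₀ _ hm', ← Complex.exp_int_mul]
    congr 1; ring

/-- The Fourier integral that represents the moments, up to a factor. -/
def fourierMoment (t : ℝ) (k : ℤ) : ℂ :=
  ∫ θ in -Real.pi..Real.pi, Complex.exp ((-k : ℤ) * (θ * Complex.I)) *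
    abelSeries (2 - k) ((Real.cos θ * Real.exp (-(1 + t)) : ℝ) : ℂ)

theorem continuous_abelSeries_cos {t : ℝ} (ht : 0 ≤ t) (m : ℤ) :
    Continuous fun θ : ℝ => abelSeries m ((Real.cos θ * Real.exp (-(1 + t)) : ℝ) : ℂ) := by
  refine (continuousOn_abelSeries m).comp_continuous (by fun_prop) fun θ => ?_
  simpa only [mem_closedBall_zero_iff] using norm_cos_mul_exp_le ht θ

theorem integral_exp_int_mul_I (n : ℤ) :
    ∫ θ in -Real.pi..Real.pi, Complex.exp (n * (θ * Complex.I)) =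
      if n = 0 then 2 * (Real.pi : ℂ) else 0 := by
  rcases eq_or_ne n 0 with rfl | hn
  · simp; ring
  · have hc : (n * Complex.I : ℂ) ≠ 0 := mul_ne_zero (by exact_mod_cast hn) Complex.I_ne_zero
    have h := integral_exp_mul_complex (a := -Real.pi) (b := Real.pi) hc
    rw [if_neg hn]
    calc _ = ∫ θ in -Real.pi..Real.pi, Complex.exp ((n * Complex.I) * θ) := by
          congr 1; ext θ; ring_nf
      _ = _ := h
      _ = 0 := by
          rw [div_eq_zero_iff, sub_eq_zero]
          left
          rw [Complex.exp_eq_exp_iff_exists_int]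
          exact ⟨n, by push_cast; ring⟩

theorem integral_powPrimitive_szegoRadius {t : ℝ} (ht : 0 ≤ t) (k : ℤ) :
    ∫ θ in -Real.pi..Real.pi, Complex.exp ((-k : ℤ) * (θ * Complex.I)) *
      (powPrimitive (2 - k) (szegoRadius t θ) : ℂ) =
      Complex.exp (-((1 + t) * (2 - k : ℤ))) * fourierMoment t k := by
  simp only [powPrimitive_szegoRadius ht, mul_add]
  rw [intervalIntegral.integral_add, intervalIntegral.integral_mul_const,
    integral_exp_int_mul_I]
  -- The additive constant occurs only for k = 2, where e^{-ikθ} has mean zero.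
  · have : (if (-k : ℤ) = 0 then 2 * (Real.pi : ℂ) else 0) *
        (if (2 - k : ℤ) = 0 then -(1 + t : ℂ) else 0) = 0 := by
      split_ifs with h1 h2 <;> first | omega | simp
    rw [this, add_zero, fourierMoment, ← intervalIntegral.integral_const_mul]
    congr 1; ext θ; ring
  · have := continuous_abelSeries_cos ht (2 - k)
    exact Continuous.intervalIntegrable (by fun_prop) _ _
  · exact Continuous.intervalIntegrable (by fun_prop) _ _

theorem continuous_powPrimitive_szegoRadius {t : ℝ} (ht : 0 ≤ t) (m : ℤ) :
    Continuous fun θ => (powPrimitive m (szegoRadius t θ) : ℂ) := by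
  have := continuous_abelSeries_cos ht m
  simp only [powPrimitive_szegoRadius ht]
  fun_prop

theorem integral_szegoDomain_zpow {t : ℝ} (ht : 0 ≤ t) {k : ℤ} (hk : k ≤ 0) :
    ∫ z in szegoDomain t, z ^ (-k) =
      Complex.exp (-((1 + t) * (2 - k : ℤ))) * fourierMoment t k := by
  rw [setIntegral_zpow_polar (isOpen_szegoDomain t).measurableSet (a := fun _ => 0)
    (b := szegoRadius t) (integrableOn_zpow_szegoDomain t (by omega))
    (fun θ => ⟨le_rfl, (szegoRadius_pos t θ).le⟩)
    (fun r θ hr => by simp [polarPoint_mem_szegoDomain_iff ht hr, hr]),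
    ← integral_powPrimitive_szegoRadius ht]
  congr 1; ext θ; congr 2
  rw [integral_zpow (Or.inl (by omega)), powPrimitive, if_neg (by omega), zero_zpow _ (by omega),
    sub_zero, show -k + 1 + 1 = 2 - k by ring]
  congr 1; push_cast; ring

/-- The primitive at R does not depend on θ, so e^{-ikθ} with k ≥ 1 removes it; the truncated
integral is already constant for R ≥ 1. -/
theorem integral_szegoCodomain_ball_zpow {t : ℝ} (ht : 0 ≤ t) {k : ℤ} (hk : 1 ≤ k) {R : ℝ}
    (hR : 1 ≤ R) :
    ∫ z in szegoCodomain t ∩ Metric.ball 0 R, z ^ (-k) =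
      -(Complex.exp (-((1 + t) * (2 - k : ℤ))) * fourierMoment t k) := by
  have hR0 : 0 < R := by linarith
  rw [setIntegral_zpow_polar ((isOpen_szegoCodomain t).inter Metric.isOpen_ball).measurableSet
    (a := szegoRadius t) (b := fun _ => R) (integrableOn_zpow_szegoCodomain_ball ht hk R)
    (fun θ => ⟨(szegoRadius_pos t θ).le, (szegoRadius_le_one ht θ).trans hR⟩)
    (fun r θ hr => by
      rw [Set.mem_inter_iff, polarPoint_mem_szegoCodomain_iff ht hr, mem_ball_zero_iff,
        norm_polarPoint hr]),
    ← integral_powPrimitive_szegoRadius ht]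
  have h1 : ∀ θ, ((∫ r in szegoRadius t θ..R, r ^ (-k + 1) : ℝ) : ℂ) =
      (powPrimitive (2 - k) R : ℂ) - (powPrimitive (2 - k) (szegoRadius t θ) : ℂ) := by
    intro θ
    rw [← Complex.ofReal_sub, ← integral_zpow_eq_powPrimitive (szegoRadius_pos t θ) hR0,
      show 2 - k - 1 = -k + 1 by ring]
  simp only [h1, mul_sub]
  have hc := continuous_powPrimitive_szegoRadius ht (2 - k)
  rw [intervalIntegral.integral_sub (Continuous.intervalIntegrable (by fun_prop) _ _)
    (Continuous.intervalIntegrable (by fun_prop) _ _), intervalIntegral.integral_mul_const,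
    integral_exp_int_mul_I, if_neg (by omega), zero_mul, zero_sub]

theorem truncatedExteriorMoment_eq {t : ℝ} (ht : 0 ≤ t) {k : ℤ} (hk : 1 ≤ k) {R : ℝ}
    (hR : 1 ≤ R) :
    truncatedExteriorMoment t k R =
      1 / (Real.pi : ℂ) * (Complex.exp (-((1 + t) * (2 - k : ℤ))) * fourierMoment t k) := by
  rw [truncatedExteriorMoment, curveExterior_szegoCurve ht,
    integral_szegoCodomain_ball_zpow ht hk hR]
  ring

theorem tendsto_truncatedExteriorMoment {t : ℝ} (ht : 0 ≤ t) {k : ℤ} (hk : 1 ≤ k) :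
    Filter.Tendsto (truncatedExteriorMoment t k) Filter.atTop (nhds
      (1 / (Real.pi : ℂ) * (Complex.exp (-((1 + t) * (2 - k : ℤ))) * fourierMoment t k))) := by
  refine tendsto_const_nhds.congr' ?_
  filter_upwards [Filter.eventually_ge_atTop 1] with R hR
  exact (truncatedExteriorMoment_eq ht hk hR).symm

theorem harmonicMoment_eq {t : ℝ} (ht : 0 ≤ t) (k : ℤ) :
    harmonicMoment t k =
      1 / (Real.pi : ℂ) * (Complex.exp (-((1 + t) * (2 - k : ℤ))) * fourierMoment t k) := by
  by_cases hk : 1 ≤ k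
  · rw [harmonicMoment, if_pos hk]
    exact (tendsto_truncatedExteriorMoment ht hk).limUnder_eq
  · rw [harmonicMoment, if_neg hk, curveInterior_szegoCurve ht,
      integral_szegoDomain_zpow ht (by omega)]

theorem harmonicMoment_eq_integral {t : ℝ} (ht : 0 ≤ t) {k : ℤ} (hk : 3 ≤ k) :
    harmonicMoment t k = -(1 / (Real.pi : ℂ)) * ∫ z in szegoCodomain t, z ^ (-k) := by
  have hU : ⋃ R : ℝ, szegoCodomain t ∩ Metric.ball 0 R = szegoCodomain t := by
    rw [← Set.inter_iUnion, Set.inter_eq_left]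
    intro z _
    exact Set.mem_iUnion.2 ⟨‖z‖ + 1, by simp⟩
  have h1 := tendsto_setIntegral_of_monotone (μ := volume) (f := fun z : ℂ => z ^ (-k))
    (s := fun R : ℝ => szegoCodomain t ∩ Metric.ball 0 R)
    (fun R => ((isOpen_szegoCodomain t).inter Metric.isOpen_ball).measurableSet)
    (fun R S h => Set.inter_subset_inter_right _ (Metric.ball_subset_ball h))
    (by rw [hU]; exact integrableOn_zpow_szegoCodomain ht hk)
  rw [hU] at h1
  rw [harmonicMoment_eq ht]
  refine tendsto_nhds_unique (tendsto_truncatedExteriorMoment ht (by omega : 1 ≤ k)) ?_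
  unfold truncatedExteriorMoment
  rw [curveExterior_szegoCurve ht]
  exact h1.const_mul _

/-! ### Fourier coefficients of powers of the cosine -/

theorem cos_pow_mul_exp (j : ℕ) (k : ℤ) (θ : ℝ) :
    (Real.cos θ : ℂ) ^ j * Complex.exp ((-k : ℤ) * (θ * Complex.I)) =
      ∑ l ∈ Finset.range (j + 1), ((2 : ℂ)⁻¹ ^ j * (j.choose l : ℂ)) *
        Complex.exp ((2 * l - j - k : ℤ) * (θ * Complex.I)) := by
  rw [Complex.ofReal_cos, Complex.cos, div_eq_inv_mul, mul_pow, add_pow, Finset.mul_sum,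
    Finset.sum_mul]
  refine Finset.sum_congr rfl fun l hl => ?_
  have hl' : l ≤ j := by simp at hl; omega
  rw [← Complex.exp_nat_mul, ← Complex.exp_nat_mul, ← Complex.exp_add]
  calc _ = (2 : ℂ)⁻¹ ^ j * (j.choose l : ℂ) *
        (Complex.exp (l * (θ * Complex.I) + (j - l : ℕ) * (-θ * Complex.I)) *
          Complex.exp ((-k : ℤ) * (θ * Complex.I))) := by ring
    _ = _ := by
        rw [← Complex.exp_add]
        congr 2
        push_cast [Nat.cast_sub hl']
        ring

theorem integral_cos_pow_mul_exp (j : ℕ) (k : ℤ) :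
    ∫ θ in -Real.pi..Real.pi, (Real.cos θ : ℂ) ^ j * Complex.exp ((-k : ℤ) * (θ * Complex.I)) =
      ∑ l ∈ Finset.range (j + 1), ((2 : ℂ)⁻¹ ^ j * (j.choose l : ℂ)) *
        if (2 * l - j - k : ℤ) = 0 then 2 * (Real.pi : ℂ) else 0 := by
  simp only [cos_pow_mul_exp]
  rw [intervalIntegral.integral_finsetSum]
  · simp only [intervalIntegral.integral_const_mul, integral_exp_int_mul_I]
  · intro l _
    exact Continuous.intervalIntegrable (by fun_prop) _ _

theorem integral_cos_pow_mul_exp_of_eq {j l : ℕ} {k : ℤ} (hl : l ≤ j) (h : (2 * l : ℤ) = j + k) :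
    ∫ θ in -Real.pi..Real.pi, (Real.cos θ : ℂ) ^ j * Complex.exp ((-k : ℤ) * (θ * Complex.I)) =
      (2 : ℂ)⁻¹ ^ j * (j.choose l : ℂ) * (2 * (Real.pi : ℂ)) := by
  rw [integral_cos_pow_mul_exp, Finset.sum_eq_single l]
  · rw [if_pos (by omega)]
  · intro b _ hb
    rw [if_neg (by omega), mul_zero]
  · intro h'
    simp at h'; omega

theorem integral_cos_pow_mul_exp_of_ne {j : ℕ} {k : ℤ}
    (h : ∀ l : ℕ, l ≤ j → (2 * l : ℤ) ≠ j + k) :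
    ∫ θ in -Real.pi..Real.pi, (Real.cos θ : ℂ) ^ j * Complex.exp ((-k : ℤ) * (θ * Complex.I)) =
      0 := by
  rw [integral_cos_pow_mul_exp]
  refine Finset.sum_eq_zero fun l hl => ?_
  simp only [Finset.mem_range] at hl
  have := h l (by omega)
  rw [if_neg (by omega), mul_zero]

/-- Termwise integration by dominated convergence, with the constants ‖a_j‖ e^{-j} as majorant. -/
theorem hasSum_fourierMoment {t : ℝ} (ht : 0 ≤ t) (k : ℤ) :
    HasSum (fun j : ℕ => abelCoeff (2 - k) j * Complex.exp (-(1 + t)) ^ j *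
      ∫ θ in -Real.pi..Real.pi,
        (Real.cos θ : ℂ) ^ j * Complex.exp ((-k : ℤ) * (θ * Complex.I)))
      (fourierMoment t k) := by
  have h := intervalIntegral.hasSum_integral_of_dominated_convergence (μ := volume)
    (a := -Real.pi) (b := Real.pi)
    (F := fun (j : ℕ) (θ : ℝ) => Complex.exp ((-k : ℤ) * (θ * Complex.I)) *
      (abelCoeff (2 - k) j * ((Real.cos θ * Real.exp (-(1 + t)) : ℝ) : ℂ) ^ j))
    (f := fun θ : ℝ => Complex.exp ((-k : ℤ) * (θ * Complex.I)) *
      abelSeries (2 - k) ((Real.cos θ * Real.exp (-(1 + t)) : ℝ) : ℂ))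
    (fun j _ => ‖abelCoeff (2 - k) j‖ * Real.exp (-1) ^ j)
    (fun j => Continuous.aestronglyMeasurable (by fun_prop))
    (fun j => Filter.Eventually.of_forall fun θ _ => by
      rw [norm_mul]
      have e : ‖Complex.exp ((-k : ℤ) * (θ * Complex.I))‖ = 1 := by
        rw [Complex.norm_exp]; simp
      rw [e, one_mul]
      exact norm_abelCoeff_mul_pow_le _ j (norm_cos_mul_exp_le ht θ))
    (Filter.Eventually.of_forall fun θ _ => summable_norm_abelCoeff (2 - k))
    intervalIntegrable_const
    (Filter.Eventually.of_forall fun θ _ =>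
      (hasSum_abelSeries (2 - k) (norm_cos_mul_exp_le ht θ)).mul_left _)
  refine h.congr_fun fun j => ?_
  rw [← intervalIntegral.integral_const_mul]
  congr 1; ext θ
  push_cast
  rw [mul_pow]
  ring

/-- The terms of the explicit series of the moments. -/
def momentTerm (t : ℝ) (k : ℤ) (n : ℕ) : ℝ :=
  ((n : ℝ) ^ (k + 2 * (n : ℤ) - 2) / ((((n : ℤ) + k - 1).toNat ! : ℝ) * (n ! : ℝ))) *
    Real.exp (-2 * (t + 1) * (n : ℝ))

/-- With j = 2n+k-2 the base 2-k+j equals 2n, so the powers of 2 cancel and n^{j-1} remains; the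
binomial coefficient cancels j!, and the spare factor 1/n turns (n-1)! into n!. -/
theorem fourier_term_eq_momentTerm (t : ℝ) {k : ℤ} {j l n : ℕ} (hl : (l : ℤ) = n + k - 1)
    (hj : (j : ℤ) = 2 * n + k - 2) (hn : 1 ≤ n) :
    1 / (Real.pi : ℂ) * (Complex.exp (-((1 + t) * (2 - k : ℤ))) *
      (abelCoeff (2 - k) j * Complex.exp (-(1 + t)) ^ j *
        ((2 : ℂ)⁻¹ ^ j * (j.choose l : ℂ) * (2 * (Real.pi : ℂ))))) = (momentTerm t k n : ℂ) := by
  obtain ⟨i, rfl⟩ : ∃ i, n = i + 1 := ⟨n - 1, by omega⟩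
  obtain rfl : j = l + i := by omega
  have hpi : (Real.pi : ℂ) ≠ 0 := by exact_mod_cast Real.pi_pos.ne'
  have hn0 : ((i : ℂ) + 1) ≠ 0 := Nat.cast_add_one_ne_zero i
  have h1 : (l ! : ℂ) ≠ 0 := by exact_mod_cast l.factorial_ne_zero
  have h2 : (i ! : ℂ) ≠ 0 := by exact_mod_cast i.factorial_ne_zero
  have h3 : ((l + i) ! : ℂ) ≠ 0 := by exact_mod_cast (l + i).factorial_ne_zero
  have hch : ((l + i).choose l : ℂ) = ((l + i) ! : ℂ) / ((l ! : ℂ) * (i ! : ℂ)) := by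
    rw [eq_div_iff (mul_ne_zero h1 h2), ← mul_assoc]
    have := Nat.choose_mul_factorial_mul_factorial (Nat.le_add_right l i)
    rw [Nat.add_sub_cancel_left] at this
    exact_mod_cast this
  have hexp : Complex.exp (-((1 + t) * (2 - k : ℤ))) * Complex.exp (-(1 + t)) ^ (l + i) =
      Complex.exp (-2 * (t + 1) * (i + 1)) := by
    rw [← Complex.exp_nat_mul, ← Complex.exp_add]
    congr 1
    have : ((l + i : ℕ) : ℂ) = 2 * ((i : ℂ) + 1) + k - 2 := by
      exact_mod_cast congrArg (fun x : ℤ => (x : ℂ)) hj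
    rw [this]
    push_cast
    ring
  have hbase : ((2 - k + (l + i : ℕ) : ℤ) : ℂ) = 2 * ((i : ℂ) + 1) := by
    rw [hj]; push_cast; ring
  have hnat : (((i + 1 : ℕ) : ℤ) + k - 1).toNat = l := by omega
  have he : k + 2 * ((i + 1 : ℕ) : ℤ) - 2 = ((l + i : ℕ) : ℤ) := by omega
  have h2j : ((2 : ℂ) * (i + 1)) ^ (((l + i : ℕ) : ℤ) - 1) * (2 : ℂ)⁻¹ ^ (l + i) * 2 =
      ((i : ℂ) + 1) ^ (l + i) * ((i : ℂ) + 1)⁻¹ := by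
    rw [zpow_sub_one₀ (mul_ne_zero two_ne_zero hn0), zpow_natCast, mul_pow, mul_inv, inv_pow]
    field_simp
  rw [momentTerm, abelCoeff, hbase, hch, hnat, he, Nat.factorial_succ, zpow_natCast]
  push_cast
  rw [← hexp]
  calc _ = Complex.exp (-((1 + t) * (2 - k : ℤ))) * Complex.exp (-(1 + t)) ^ (l + i) *
        (((2 : ℂ) * (i + 1)) ^ (((l + i : ℕ) : ℤ) - 1) * (2 : ℂ)⁻¹ ^ (l + i) * 2) /
        ((l ! : ℂ) * (i ! : ℂ)) := by
        push_cast; field_simp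
    _ = _ := by
        rw [h2j]; push_cast; field_simp

theorem hasSum_momentTerm {t : ℝ} (ht : 0 ≤ t) (k : ℤ) :
    HasSum (fun n : {n : ℕ // max 1 (1 - k) ≤ (n : ℤ)} => (momentTerm t k n : ℂ))
      (harmonicMoment t k) := by
  rw [harmonicMoment_eq ht]
  have h := ((hasSum_fourierMoment ht k).mul_left
    (Complex.exp (-((1 + t) * (2 - k : ℤ))))).mul_left (1 / (Real.pi : ℂ))
  -- Only exponents j = 2n+k-2 contribute: the frequency k occurs in cos^j θ only if j + k = 2l with
  -- 0 ≤ l ≤ j, and then n = j-l+1.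
  have hg : Function.Injective
      fun n : {n : ℕ // max 1 (1 - k) ≤ (n : ℤ)} => (2 * ((n : ℕ) : ℤ) + k - 2).toNat := by
    intro ⟨a, ha⟩ ⟨b, hb⟩ hab
    simp only [max_le_iff] at ha hb
    simp only [Subtype.mk.injEq] at hab ⊢
    omega
  have h' := (hg.hasSum_iff ?_).2 h
  · refine h'.congr_fun fun ⟨n, hn⟩ => ?_
    simp only [max_le_iff] at hn
    have hl : (((n : ℤ) + k - 1).toNat : ℤ) = n + k - 1 := by omega
    have hj : ((2 * (n : ℤ) + k - 2).toNat : ℤ) = 2 * n + k - 2 := by omega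
    rw [← fourier_term_eq_momentTerm t hl hj (by omega)]
    simp only [Function.comp_apply]
    rw [integral_cos_pow_mul_exp_of_eq (l := ((n : ℤ) + k - 1).toNat) (by omega) (by omega)]
  · intro j hj
    rw [integral_cos_pow_mul_exp_of_ne, mul_zero, mul_zero, mul_zero]
    intro l hl heq
    refine hj ⟨⟨j - l + 1, ?_⟩, ?_⟩
    · rw [max_le_iff]; push_cast [Nat.cast_sub hl]; omega
    · push_cast [Nat.cast_sub hl]; omega

/-! ### The Laurent expansion -/

/-- The terms of the double series of `S(z,t)`. -/
def schwarzTerm (t : ℝ) (z : ℂ) (p : ℕ × ℕ) : ℂ :=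
  abelCoeff 0 p.1 * (Complex.exp (-2 * ((t : ℂ) + 1)) * z⁻¹) ^ p.1 *
    ((p.1 * z) ^ p.2 / (p.2 ! : ℂ))

/-- The norms in row n sum to |a_n| (e^{-2(t+1)} e^{|z|}/|z|)^n, and the annulus is where the base
is below 1/e. -/
theorem summable_schwarzTerm {t : ℝ} (ht : 0 < t) {z : ℂ} (hz : z ∈ laurentAnnulus t) :
    Summable (schwarzTerm t z) := by
  have hrow : ∀ n : ℕ, HasSum (fun i => ‖schwarzTerm t z (n, i)‖)
      (‖abelCoeff 0 n * (Complex.exp (-2 * ((t : ℂ) + 1)) * z⁻¹) ^ n‖ *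
        Real.exp (n * ‖z‖)) := by
    intro n
    have h := (hasSum_real_exp (n * ‖z‖)).mul_left
      ‖abelCoeff 0 n * (Complex.exp (-2 * ((t : ℂ) + 1)) * z⁻¹) ^ n‖
    refine h.congr_fun fun i => ?_
    rw [schwarzTerm, norm_mul, norm_div, norm_pow, norm_mul (n : ℂ), Complex.norm_natCast,
      Complex.norm_natCast]
  apply Summable.of_norm
  rw [summable_prod_of_nonneg (fun _ => norm_nonneg _)]
  refine ⟨fun n => (hrow n).summable, ?_⟩
  simp only [(hrow _).tsum_eq]
  refine (summable_norm_abelCoeff 0).of_nonneg_of_le (fun _ => by positivity) fun n => ?_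
  have e : ‖Complex.exp (-2 * ((t : ℂ) + 1)) * z⁻¹‖ = Real.exp (-2 * (t + 1)) * ‖z‖⁻¹ := by
    simp [Complex.norm_exp]
  rw [norm_mul, norm_pow, e, mul_assoc, Real.exp_nat_mul, ← mul_pow]
  gcongr
  exact (majorant_lt_of_mem_laurentAnnulus ht hz).le

theorem hasSum_schwarzTerm {t : ℝ} (ht : 0 < t) {z : ℂ} (hz : z ∈ laurentAnnulus t) :
    HasSum (schwarzTerm t z) (schwarzS t z) := by
  have hs := summable_schwarzTerm ht hz
  have hlt := (ne_zero_and_norm_schwarzArg_lt ht (Or.inr hz)).2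
  have h1 : HasSum (fun n : ℕ => abelCoeff 0 n * schwarzArg t z ^ n) (∑' p, schwarzTerm t z p) := by
    refine hs.hasSum.prod_fiberwise fun n => ?_
    have h := (hasSum_complex_exp (n * z)).mul_left
      (abelCoeff 0 n * (Complex.exp (-2 * ((t : ℂ) + 1)) * z⁻¹) ^ n)
    rw [schwarzArg, mul_pow, ← Complex.exp_nat_mul, ← mul_assoc]
    exact h
  rw [schwarzS_eq_treeFun hlt, (hasSum_treeFun hlt.le).unique h1]
  exact hs.hasSum

/-- With j = n+k-1, n^{n-1} n^j = n^{k+2n-2} and z^{j-n} = z^{k-1}. -/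
theorem schwarzTerm_eq_momentTerm (t : ℝ) {z : ℂ} (hz : z ≠ 0) {k : ℤ} {n j : ℕ}
    (hj : (j : ℤ) = n + k - 1) (hn : 1 ≤ n) :
    schwarzTerm t z (n, j) = momentTerm t k n * z ^ (k - 1) := by
  have hn0 : (n : ℂ) ≠ 0 := by exact_mod_cast (by omega : n ≠ 0)
  have hnat : ((n : ℤ) + k - 1).toNat = j := by omega
  have h1 : (n : ℂ) ^ (k + 2 * (n : ℤ) - 2) = (n : ℂ) ^ ((n : ℤ) - 1) * (n : ℂ) ^ j := by
    rw [← zpow_natCast _ j, ← zpow_add₀ hn0, hj]; congr 1; ring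
  have h2 : z ^ (k - 1) = z⁻¹ ^ n * z ^ j := by
    rw [inv_pow, ← zpow_natCast, ← zpow_natCast, ← zpow_neg, ← zpow_add₀ hz, hj]
    congr 1; ring
  have h3 : Complex.exp (-2 * ((t : ℂ) + 1) * n) = Complex.exp (-2 * ((t : ℂ) + 1)) ^ n := by
    rw [← Complex.exp_nat_mul]; congr 1; ring
  rw [schwarzTerm, momentTerm, hnat, abelCoeff, h2]
  push_cast
  rw [h1, h3, mul_pow, mul_pow, zero_add]
  field_simp

theorem hasSum_harmonicMoment_mul_zpow {t : ℝ} (ht : 0 < t) {z : ℂ}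
    (hz : z ∈ laurentAnnulus t) :
    HasSum (fun k : ℤ => harmonicMoment t k * z ^ (k - 1)) (schwarzS t z) := by
  have hz0 := ne_zero_of_mem_laurentAnnulus ht hz
  let g : (Σ k : ℤ, {n : ℕ // max 1 (1 - k) ≤ (n : ℤ)}) → ℕ × ℕ :=
    fun p => (p.2, (((p.2 : ℕ) : ℤ) + p.1 - 1).toNat)
  have hg : Function.Injective g := by
    rintro ⟨k, n, hn⟩ ⟨k', n', hn'⟩ h
    simp only [max_le_iff] at hn hn'
    simp only [g, Prod.mk.injEq] at h
    obtain ⟨rfl, h⟩ := h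
    obtain rfl : k = k' := by omega
    rfl
  have h := (hg.hasSum_iff (f := schwarzTerm t z) ?_).2 (hasSum_schwarzTerm ht hz)
  · refine h.sigma fun k => ?_
    refine ((hasSum_momentTerm ht.le k).mul_right (z ^ (k - 1))).congr_fun fun ⟨n, hn⟩ => ?_
    simp only [max_le_iff] at hn
    have hj : (((n : ℤ) + k - 1).toNat : ℤ) = n + k - 1 := by omega
    have hn1 : 1 ≤ n := by omega
    exact schwarzTerm_eq_momentTerm t hz0 hj hn1
  · rintro ⟨n, j⟩ hnj
    rcases n.eq_zero_or_pos with rfl | hn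
    -- Row n = 0 lies outside the range of the reindexing, but it vanishes since 0^{-1} = 0.
    · simp [schwarzTerm, abelCoeff]
    · refine absurd ⟨⟨(j : ℤ) - n + 1, n, ?_⟩, ?_⟩ hnj
      · rw [max_le_iff]; omega
      · simp only [g, Prod.mk.injEq, true_and]; omega

end

theorem mainTheorem2 (t : ℝ) (ht : 0 ≤ t) :
    -- the integrals defining the harmonic moments exist
    (∀ k : ℤ, k ≤ 0 →
      MeasureTheory.IntegrableOn (fun z : ℂ => z ^ (-k)) (curveInterior (szegoCurve t))) ∧
    (∀ k : ℤ, 1 ≤ k →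
      (∀ R : ℝ, MeasureTheory.IntegrableOn (fun z : ℂ => z ^ (-k))
        (curveExterior (szegoCurve t) ∩ Metric.ball 0 R)) ∧
      Filter.Tendsto (truncatedExteriorMoment t k) Filter.atTop (nhds (harmonicMoment t k))) ∧
    (∀ k : ℤ, 3 ≤ k →
      MeasureTheory.IntegrableOn (fun z : ℂ => z ^ (-k)) (curveExterior (szegoCurve t)) ∧
      harmonicMoment t k =
        -(1 / (Real.pi : ℂ)) * ∫ z in curveExterior (szegoCurve t), z ^ (-k)) ∧
    -- for `t > 0`, `S(·,t)` is the Schwarz function of `γ_t`, analytic on the curve and on the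
    -- annulus, which contains the unit circle, and the moments are its Laurent coefficients
    (0 < t →
      (0 < innerRadius t ∧ innerRadius t < 1 ∧ 1 < outerRadius t) ∧
      AnalyticOnNhd ℂ (schwarzS t) (szegoCurve t ∪ laurentAnnulus t) ∧
      (∀ z ∈ szegoCurve t ∪ laurentAnnulus t,
        (starRingEnd ℂ) z = schwarzS t z ↔ z ∈ szegoCurve t) ∧
      (∀ z ∈ laurentAnnulus t,
        HasSum (fun k : ℤ => harmonicMoment t k * z ^ (k - 1)) (schwarzS t z))) ∧
    -- the explicit formula
    (∀ k : ℤ,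
      HasSum
        (fun n : {n : ℕ // max 1 (1 - k) ≤ (n : ℤ)} =>
          ((((n : ℕ) : ℝ) ^ (k + 2 * ((n : ℕ) : ℤ) - 2) /
              (((((n : ℕ) : ℤ) + k - 1).toNat ! : ℝ) * ((n : ℕ) ! : ℝ)) *
            Real.exp (-2 * (t + 1) * ((n : ℕ) : ℝ)) : ℝ) : ℂ))
        (harmonicMoment t k)) := by
  rw [curveInterior_szegoCurve ht, curveExterior_szegoCurve ht]
  refine ⟨fun k hk => integrableOn_zpow_szegoDomain t (by omega), fun k hk => ⟨fun R =>
    integrableOn_zpow_szegoCodomain_ball ht hk R, ?_⟩, fun k hk =>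
    ⟨integrableOn_zpow_szegoCodomain ht hk, harmonicMoment_eq_integral ht hk⟩, fun ht0 =>
    ⟨⟨innerRadius_pos ht0, innerRadius_lt_one ht0, one_lt_outerRadius ht0⟩, fun z hz => ?_,
    fun z hz => ?_, fun z hz => hasSum_harmonicMoment_mul_zpow ht0 hz⟩,
    fun k => hasSum_momentTerm ht k⟩
  · rw [harmonicMoment_eq ht]
    exact tendsto_truncatedExteriorMoment ht hk
  · obtain ⟨h0, h1⟩ := ne_zero_and_norm_schwarzArg_lt ht0 hz
    exact analyticAt_schwarzS h0 h1
  · obtain ⟨h0, h1⟩ := ne_zero_and_norm_schwarzArg_lt ht0 hz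
    exact conj_eq_schwarzS_iff ht0 h0 h1
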